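/- Let $\omega:[0,\infty)\to[0,\infty)$ be a concave, strictly increasing modulus of continuity (so $\omega(0)=\omega(0^+)=0$) with $\lim_{t\to\infty}\omega(t)=\infty$, and let $\theta(t)=\int_0^t\omega(s)\,ds$. A function $\varphi:Z\to\mathbb{R}$ on a finite-dimensional Euclidean space $Z$ is of class $C^{1,\omega}_{\mathrm{loc}}$ if it is differentiable and $\sup\{|\nabla\varphi(u)-\nabla\varphi(v)|/\omega(|u-v|) : u,v\in B_Z(0,R),\,u\ne v\}<\infty$ for every $R>0$, where $B_Z(0,R)$ is the closed ball in $Z$. A function $c:Z\to\mathbb{R}$ is essentially coercive if $\lim_{|x|\to\infty}(c(x)-\ell(x))=\infty$ for some linear $\ell:Z\to\mathbb{R}$. For a convex $F:\mathbb{R}^n\to\mathbb{R}$, $X_F$ denotes the unique linear subspace of $\mathbb{R}^n$ for which $F$ can be written as $F(x)=c(P_{X_F}(x))+\langle v,x\rangle$ with $c:X_F\to\mathbb{R}$ essentially coercive and $v\in X_F^{\perp}$, where $P_{X_F}$ is the orthogonal projection onto $X_F$. Let $\mathrm{conv}(g)(x)=\sup\{\psi(x):\psi:\mathbb{R}^n\to\mathbb{R}\text{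 convex},\ \psi\le g\}$. **Theorem.** Let $E\subseteq\mathbb{R}^n$ be nonempty, $X\subseteq\mathbb{R}^n$ a linear subspace, $P=P_X:\mathbb{R}^n\to X$ the orthogonal projection, $f:E\to\mathbb{R}$ and $G:E\to\mathbb{R}^n$. There exists a convex function $F:\mathbb{R}^n\to\mathbb{R}$ of class $C^{1,\omega}_{\mathrm{loc}}$ with $F|_E=f$, $(\nabla F)|_E=G$ and $X_F=X$ if and only if the following conditions hold. (i) $Y:=\mathrm{span}\{G(y)-G(z):y,z\in E\}\subseteq X$. (ii) If $k:=\dim Y<d:=\dim X$, then there exist distinct points $p_1,\dots,p_{d-k}\in\mathbb{R}^n\setminus E$, numbers $\beta_1,\dots,\beta_{d-k}\in\mathbb{R}$, vectors $w_1,\dots,w_{d-k}\in\mathbb{R}^n$ and, for every $y\in E^*:=E\cup\{p_1,\dots,p_{d-k}\}$, a (not necessarily convex) function $\varphi_y:X\to[0,\infty)$ of class $C^{1,\omega}_{\mathrm{loc}}$ such that, with $t_y:=f(y)$, $\xi_y:=G(y)$ for $y\in E$ and $t_{p_j}:=\beta_j$, $\xi_{p_j}:=w_j$ for $1\le j\le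 d-k$: 1. $\mathrm{span}\{\xi_y-\xi_z:y,z\in E^*\}=X$; 2. $\varphi_y(P(y))=0$ and $\nabla\varphi_y(P(y))=0$ for every $y\in E^*$; 3. for every $R>0$, $\sup\left\{\frac{|\nabla\varphi_y(u)-\nabla\varphi_y(v)|}{\omega(|u-v|)} : y\in E^*\cap P^{-1}(B_X(0,R)),\ u,v\in B_X(0,R),\ u\ne v\right\}<\infty$; 4. $t_z+\langle\xi_z,x-z\rangle\le t_y+\langle\xi_y,x-y\rangle+\varphi_y(P(x))$ for all $y,z\in E^*$ and $x\in\mathbb{R}^n$. (iii) If $k=d$, then there are functions $\varphi_y:X\to[0,\infty)$, $y\in E$, of class $C^{1,\omega}_{\mathrm{loc}}$ satisfying 1--4 with $E^*=E$, $t_y=f(y)$, $\xi_y=G(y)$ (no new data are added). Moreover, whenever these conditions are satisfied, for any such data $p_j,\beta_j,w_j,\varphi_y$ (just $\varphi_y$, with $E^*=E$, if $k=d$) and every $a>0$, the infima below and the convex envelope are finite everywhere, and the formula $$F=\mathrm{conv}\left(x\mapsto\inf_{y\in E^*}\left\{t_y+\langle\xi_y,x-y\rangle+\varphi_y(P(x))+a\,\theta(|P(x-y)|)\right\}\right)$$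 defines a convex function of class $C^{1,\omega}_{\mathrm{loc}}$ with $F|_E=f$, $(\nabla F)|_E=G$ and $X_F=X$. -/

import Mathlib

namespace ConvexJet

open Set Filter Topology

/-- A concave, strictly increasing modulus of continuity `ω : [0, ∞) → [0, ∞)` with
`ω(∞) = ∞`.  Only the values of `ω` on `[0, ∞)` are ever used. -/
structure IsModulus (ω : ℝ → ℝ) : Prop where
  map_zero : ω 0 = 0
  tendsto_zero : Tendsto ω (𝓝[>] 0) (𝓝 0)
  concaveOn : ConcaveOn ℝ (Ici 0) ω
  strictMonoOn : StrictMonoOn ω (Ici 0)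
  tendsto_atTop : Tendsto ω atTop atTop

/-- `θ(t) = ∫₀ᵗ ω(s) ds`. -/
noncomputable def theta (ω : ℝ → ℝ) (t : ℝ) : ℝ := ∫ s in (0 : ℝ)..t, ω s

section General

variable {Z : Type*} [NormedAddCommGroup Z] [InnerProductSpace ℝ Z]

/-- `φ` is of class `C^{1,ω}_loc` on the (finite-dimensional) Euclidean space `Z`: it is
differentiable, and for every `R > 0` the supremum of `|∇φ(u) - ∇φ(v)| / ω(|u - v|)` over all
`u ≠ v` in the closed ball `B(0, R)` is finite. -/
def IsC1OmegaLoc [CompleteSpace Z] (ω : ℝ → ℝ) (φ : Z → ℝ) : Prop :=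
  Differentiable ℝ φ ∧
    ∀ R : ℝ, 0 < R → ∃ M : ℝ, ∀ u v : Z, ‖u‖ ≤ R → ‖v‖ ≤ R → u ≠ v →
      ‖gradient φ u - gradient φ v‖ / ω ‖u - v‖ ≤ M

/-- `c` is essentially coercive on `Z`: for some linear function `ℓ`,
`c(x) - ℓ(x) → ∞` as `|x| → ∞`. -/
def EssCoercive (c : Z → ℝ) : Prop :=
  ∃ l : Z →ₗ[ℝ] ℝ, Tendsto (fun x => c x - l x) (Bornology.cobounded Z) atTop

/-- `X_F = X`: the function `F` has the form `F = c ∘ P_X + ⟨v, ·⟩` with `c : X → ℝ` essentially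
coercive and `v ∈ Xᗮ`.  There is at most one such `X`, see `HasCoerciveSubspace.unique`. -/
def HasCoerciveSubspace (F : Z → ℝ) (X : Submodule ℝ Z) [X.HasOrthogonalProjection] : Prop :=
  ∃ (c : X → ℝ) (v : Z), EssCoercive c ∧ v ∈ Xᗮ ∧
    ∀ x : Z, F x = c (X.orthogonalProjectionOnto x) + inner ℝ v x

/-- `X_F` is well defined: at most one subspace satisfies its defining property. -/
theorem HasCoerciveSubspace.unique {F : Z → ℝ} {X Y : Submodule ℝ Z}
    [X.HasOrthogonalProjection] [Y.HasOrthogonalProjection]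
    (hX : HasCoerciveSubspace F X) (hY : HasCoerciveSubspace F Y) : X = Y := by
  -- a direction orthogonal to one of the two subspaces is orthogonal to the other one
  have key : ∀ (X Y : Submodule ℝ Z) [X.HasOrthogonalProjection] [Y.HasOrthogonalProjection],
      HasCoerciveSubspace F X → HasCoerciveSubspace F Y → Xᗮ ≤ Yᗮ := by
    intro X Y _ _ hX hY h hh
    obtain ⟨c, v, -, -, hF⟩ := hX
    obtain ⟨c', v', ⟨l, hl⟩, -, hF'⟩ := hY
    rw [← Submodule.orthogonalProjectionOnto_eq_zero_iff] at hh ⊢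
    by_contra hu
    set u := Y.orthogonalProjectionOnto h with hu_def
    have hline : ∀ s : ℝ, c' (s • u) - l (s • u) =
        c 0 + s * (inner ℝ v h - inner ℝ v' h - l u) := by
      intro s
      have h1 := hF (s • h)
      have h2 := hF' (s • h)
      rw [map_smul, hh, smul_zero, inner_smul_right] at h1
      rw [map_smul, ← hu_def, inner_smul_right] at h2
      rw [map_smul, smul_eq_mul]
      linarith
    have hev := hl.eventually (eventually_gt_atTop (c 0))
    rw [← comap_norm_atTop, eventually_comap] at hev
    obtain ⟨R, hR⟩ := (hev.and (eventually_ge_atTop 0)).exists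
    have hun : ‖u‖ ≠ 0 := norm_ne_zero_iff.mpr hu
    have hn : ‖(R / ‖u‖) • u‖ = R := by
      rw [norm_smul, Real.norm_of_nonneg (div_nonneg hR.2 (norm_nonneg _)), div_mul_cancel₀ _ hun]
    have h3 := hR.1 ((R / ‖u‖) • u) hn
    have h4 := hR.1 ((-(R / ‖u‖)) • u) (by rw [neg_smul, norm_neg, hn])
    rw [hline] at h3 h4
    linarith
  have h1 : Xᗮ = Yᗮ := le_antisymm (key X Y hX hY) (key Y X hY hX)
  rw [← X.orthogonal_orthogonal, h1, Y.orthogonal_orthogonal]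

/-- `C` is the convex envelope of `g`: at each point, `C(x)` is the (finite) supremum of `ψ(x)`
over all convex functions `ψ ≤ g`. -/
def IsConvexEnvelope (g C : Z → ℝ) : Prop :=
  ∀ x : Z, IsLUB {r : ℝ | ∃ ψ : Z → ℝ, ConvexOn ℝ univ ψ ∧ (∀ z, ψ z ≤ g z) ∧ ψ x = r} (C x)

/-- The linear span of all the differences `ξ_i - ξ_j`. -/
def diffSpan {ι : Type*} (ξ : ι → Z) : Submodule ℝ Z :=
  Submodule.span ℝ {d : Z | ∃ i j : ι, d = ξ i - ξ j}

end General

section Euclidean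

variable {n : ℕ}

/-- `F` is a convex function of class `C^{1,ω}_loc` on `ℝⁿ` with `F = f` and `∇F = G` on `E`, and
`X_F = X`. -/
structure IsConvexExtension (ω : ℝ → ℝ) (X : Submodule ℝ (EuclideanSpace ℝ (Fin n)))
    (E : Set (EuclideanSpace ℝ (Fin n))) (f : E → ℝ) (G : E → EuclideanSpace ℝ (Fin n))
    (F : EuclideanSpace ℝ (Fin n) → ℝ) : Prop where
  convexOn : ConvexOn ℝ univ F
  isC1OmegaLoc : IsC1OmegaLoc ω F
  eq_on : ∀ y : E, F y = f y
  gradient_eq_on : ∀ y : E, gradient F y = G y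
  coerciveSubspace : HasCoerciveSubspace F X

/-- The conditions on the functions `φ_y : X → [0, ∞)` associated with a jet `(t_y, ξ_y)`
on a set of points, the set being given by an indexing `pt : ι → ℝⁿ` of its points. -/
structure IsAdmissible (ω : ℝ → ℝ) (X : Submodule ℝ (EuclideanSpace ℝ (Fin n))) {ι : Type*}
    (pt : ι → EuclideanSpace ℝ (Fin n)) (t : ι → ℝ) (ξ : ι → EuclideanSpace ℝ (Fin n))
    (φ : ι → X → ℝ) : Prop where
  nonneg : ∀ i u, 0 ≤ φ i u
  isC1OmegaLoc : ∀ i, IsC1OmegaLoc ω (φ i)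
  span_eq : diffSpan ξ = X
  map_eq_zero : ∀ i, φ i (X.orthogonalProjectionOnto (pt i)) = 0
  gradient_eq_zero : ∀ i, gradient (φ i) (X.orthogonalProjectionOnto (pt i)) = 0
  uniform : ∀ R : ℝ, 0 < R → ∃ M : ℝ, ∀ (i : ι) (u v : X),
    ‖X.orthogonalProjectionOnto (pt i)‖ ≤ R → ‖u‖ ≤ R → ‖v‖ ≤ R → u ≠ v →
      ‖gradient (φ i) u - gradient (φ i) v‖ / ω ‖u - v‖ ≤ M
  tangent_le : ∀ (i j : ι) (x : EuclideanSpace ℝ (Fin n)),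
    t j + inner ℝ (ξ j) (x - pt j) ≤
      t i + inner ℝ (ξ i) (x - pt i) + φ i (X.orthogonalProjectionOnto x)

/-- `F = conv (x ↦ inf_y { t_y + ⟨ξ_y, x - y⟩ + φ_y(P x) + a θ(|P (x - y)|) })`, the infimum and
the supremum in the definition of the convex envelope being finite at every point. -/
def IsFormula (ω : ℝ → ℝ) (X : Submodule ℝ (EuclideanSpace ℝ (Fin n))) {ι : Type*}
    (pt : ι → EuclideanSpace ℝ (Fin n)) (t : ι → ℝ) (ξ : ι → EuclideanSpace ℝ (Fin n))
    (φ : ι → X → ℝ) (a : ℝ) (F : EuclideanSpace ℝ (Fin n) → ℝ) : Prop :=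
  ∃ g : EuclideanSpace ℝ (Fin n) → ℝ,
    (∀ x, IsGLB (range fun i : ι =>
      t i + inner ℝ (ξ i) (x - pt i) + φ i (X.orthogonalProjectionOnto x)
        + a * theta ω ‖X.orthogonalProjectionOnto (x - pt i)‖) (g x)) ∧
    IsConvexEnvelope g F

end Euclidean

end ConvexJet

namespace ConvexJet

open Set Filter Topology

/-! Sufficiency. Differences of the slopes `ξ` lie in `X`, so all `ξ i` share one component `v ∈
Xᗮ`; after subtracting `⟨v, ·⟩` the problem lives on `X`, where the projected slopes affinely span
the space. Let `h` be the infimum in the formula. By condition 4, `h` lies above every affine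
function of the jet, and affinely spanning slopes make the supremum of these functions grow like a
linear function plus `c‖u‖` (`exists_coercive_bound`).

Regularity is carried by one-sided bounds on second differences. The term `a θ` forces almost
minimizing indices to have base points in a bounded set, so the locally uniform bounds on `φ` make
`h` locally semiconcave (`locSemiconcave_of_isGLB`). Coercivity lets the convex envelope inherit
this (`LocSemiconcave.convEnv`), and a convex, locally semiconcave function is `C^{1,ω}_loc`
(`isC1OmegaLoc_of_locSemiconcave`). At a base point the envelope is squeezed between the jet's
affine function and `h`, which agree there; this gives its value and its gradient.

Necessity. The gradients of `F` affinely span `X`, for otherwise `F` would be affine along a line in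
`X`, against essential coercivity. Hence finitely many extra points complete the span, one per
missing dimension, and the first-order Taylor remainders of `c`, where `F = c ∘ P + ⟨v, ·⟩`, serve
as the functions `φ` (`exists_isAdmissible`). -/

theorem theta_zero (ω : ℝ → ℝ) : theta ω 0 = 0 := by simp [theta]

theorem theta_eq_integral_max (ω : ℝ → ℝ) {t : ℝ} (ht : 0 ≤ t) :
    theta ω t = ∫ s in (0 : ℝ)..t, ω (max s 0) := by
  refine intervalIntegral.integral_congr fun s hs => ?_
  rw [uIcc_of_le ht] at hs
  simp [max_eq_left hs.1]

/-! ### The modulus `ω` and its primitive `θ`. -/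

namespace IsModulus

variable {ω : ℝ → ℝ} (hω : IsModulus ω)
include hω

theorem monotoneOn : MonotoneOn ω (Ici 0) := hω.strictMonoOn.monotoneOn

theorem mono {s t : ℝ} (hs : 0 ≤ s) (hst : s ≤ t) : ω s ≤ ω t :=
  hω.monotoneOn hs (hs.trans hst) hst

theorem nonneg {t : ℝ} (ht : 0 ≤ t) : 0 ≤ ω t := by
  simpa [hω.map_zero] using hω.mono le_rfl ht

theorem pos {t : ℝ} (ht : 0 < t) : 0 < ω t := by
  simpa [hω.map_zero] using hω.strictMonoOn self_mem_Ici ht.le ht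

theorem two_mul_le {t : ℝ} (ht : 0 ≤ t) : ω (2 * t) ≤ 2 * ω t := by
  have h := hω.concaveOn.2 (show (0 : ℝ) ∈ Ici 0 from self_mem_Ici)
    (show 2 * t ∈ Ici 0 from mem_Ici.2 (by positivity))
    (show (0 : ℝ) ≤ 1 / 2 by norm_num) (show (0 : ℝ) ≤ 1 / 2 by norm_num) (by norm_num)
  simp only [smul_eq_mul, hω.map_zero] at h
  have e : (1 / 2 : ℝ) * 0 + 1 / 2 * (2 * t) = t := by ring
  rw [e] at h
  linarith

theorem div_antitone {s t : ℝ} (hs : 0 < s) (hst : s ≤ t) : ω t / t ≤ ω s / s := by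
  have ht : 0 < t := hs.trans_le hst
  have h := hω.concaveOn.2 (show (0 : ℝ) ∈ Ici 0 from self_mem_Ici)
    (show t ∈ Ici 0 from ht.le)
    (show (0 : ℝ) ≤ 1 - s / t by rw [sub_nonneg, div_le_one ht]; exact hst)
    (show (0 : ℝ) ≤ s / t by positivity) (by ring)
  simp only [smul_eq_mul, hω.map_zero, mul_zero, zero_add, div_mul_cancel₀ _ ht.ne'] at h
  rw [div_le_div_iff₀ ht hs]
  calc ω t * s = (s / t * ω t) * t := by field_simp
    _ ≤ ω s * t := by gcongr

/-- The extension of `ω` by zero to the negative half-line is continuous. -/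
theorem continuous_max : Continuous fun s => ω (max s 0) := by
  have hc : ContinuousOn ω (Ici 0) := by
    intro t ht
    rcases eq_or_lt_of_le (show (0 : ℝ) ≤ t from ht) with rfl | ht
    · rw [← continuousWithinAt_Ioi_iff_Ici, ContinuousWithinAt, hω.map_zero]
      exact hω.tendsto_zero
    · have h := hω.concaveOn.continuousOn_interior
      rw [interior_Ici] at h
      exact (h.continuousAt (Ioi_mem_nhds ht)).continuousWithinAt
  exact hc.comp_continuous (by fun_prop) fun s => le_max_right s 0

theorem hasDerivAt_theta {t : ℝ} (ht : 0 < t) : HasDerivAt (theta ω) (ω t) t := by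
  have h := hω.continuous_max.integral_hasStrictDerivAt 0 t |>.hasDerivAt
  rw [max_eq_left ht.le] at h
  refine h.congr_of_eventuallyEq ?_
  filter_upwards [Ioi_mem_nhds ht] with s hs
  exact theta_eq_integral_max ω (le_of_lt hs)

theorem continuousOn_theta : ContinuousOn (theta ω) (Ici 0) := by
  have h : Continuous fun t => ∫ s in (0 : ℝ)..t, ω (max s 0) :=
    intervalIntegral.continuous_primitive (fun a b => hω.continuous_max.intervalIntegrable a b) 0
  exact h.continuousOn.congr fun t ht => theta_eq_integral_max ω ht

theorem theta_monotoneOn : MonotoneOn (theta ω) (Ici 0) := by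
  refine monotoneOn_of_deriv_nonneg (convex_Ici 0) hω.continuousOn_theta ?_ ?_ <;>
    rw [interior_Ici]
  · exact fun t ht => (hω.hasDerivAt_theta ht).differentiableAt.differentiableWithinAt
  · intro t ht
    rw [(hω.hasDerivAt_theta ht).deriv]
    exact hω.nonneg (le_of_lt ht)

theorem theta_nonneg {t : ℝ} (ht : 0 ≤ t) : 0 ≤ theta ω t := by
  simpa [theta_zero] using hω.theta_monotoneOn self_mem_Ici ht ht

theorem sub_mul_le_theta {s t : ℝ} (hs : 0 ≤ s) (hst : s ≤ t) : (t - s) * ω s ≤ theta ω t - theta ω s := by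
  rcases hst.eq_or_lt with rfl | hst
  · simp
  obtain ⟨c, hc, h⟩ := exists_hasDerivAt_eq_slope (theta ω) ω hst
    (hω.continuousOn_theta.mono fun x hx => hs.trans hx.1)
    (fun x hx => hω.hasDerivAt_theta (hs.trans_lt hx.1))
  rw [eq_div_iff (sub_pos.2 hst).ne'] at h
  rw [← h, mul_comm]
  exact mul_le_mul_of_nonneg_right (hω.mono hs hc.1.le) (sub_pos.2 hst).le

theorem theta_le_mul {t : ℝ} (ht : 0 ≤ t) : theta ω t ≤ t * ω t := by
  rcases ht.eq_or_lt with rfl | ht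
  · simp [theta_zero]
  obtain ⟨c, hc, h⟩ := exists_hasDerivAt_eq_slope (theta ω) ω ht
    (hω.continuousOn_theta.mono fun x hx => hx.1)
    (fun x hx => hω.hasDerivAt_theta hx.1)
  rw [eq_div_iff (sub_pos.2 ht).ne', theta_zero, sub_zero, sub_zero] at h
  rw [← h, mul_comm]
  exact mul_le_mul_of_nonneg_left (hω.mono hc.1.le hc.2.le) ht.le

theorem exists_lt_theta (K : ℝ) : ∃ r, 0 ≤ r ∧ ∀ t, r < t → K < theta ω t := by
  have h1 := hω.pos one_pos
  refine ⟨1 + |K| / ω 1, by positivity, fun t ht => ?_⟩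
  have h2 : (0 : ℝ) ≤ |K| / ω 1 := by positivity
  have h3 := hω.sub_mul_le_theta zero_le_one (show (1 : ℝ) ≤ t by linarith)
  have h4 : |K| < (t - 1) * ω 1 := by
    rw [← div_lt_iff₀ h1]; linarith
  have h5 := hω.theta_nonneg zero_le_one
  linarith [le_abs_self K]

/-- The derivative is `ω(√t) / (2√t)`, which decreases because `ω` is concave and vanishes at `0`.
Composing with the square root makes the parallelogram law applicable to `θ(‖x‖)`. -/
theorem concaveOn_theta_sqrt : ConcaveOn ℝ (Ici 0) fun t => theta ω √t := by
  have hd : ∀ t ∈ Ioi (0 : ℝ), HasDerivAt (fun t => theta ω √t) (ω √t * (1 / (2 * √t))) t :=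
    fun t ht => (hω.hasDerivAt_theta (Real.sqrt_pos.2 ht)).comp t
      (Real.hasDerivAt_sqrt (ne_of_gt ht))
  refine AntitoneOn.concaveOn_of_deriv (convex_Ici 0)
    (hω.continuousOn_theta.comp Real.continuous_sqrt.continuousOn fun t _ => Real.sqrt_nonneg t)
    ?_ ?_ <;> rw [interior_Ici]
  · exact fun t ht => (hd t ht).differentiableAt.differentiableWithinAt
  · intro s hs t ht hst
    rw [(hd s hs).deriv, (hd t ht).deriv]
    have h := hω.div_antitone (Real.sqrt_pos.2 hs) (Real.sqrt_le_sqrt hst)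
    have e : ∀ r : ℝ, ω r * (1 / (2 * r)) = ω r / r / 2 := fun r => by
      rw [div_div, mul_one_div, mul_comm r]
    rw [e, e]
    linarith

/-- `x ↦ θ(|x|)` is semiconcave with modulus `2 θ`. -/
theorem theta_norm_add_sub_le {Z : Type*} [NormedAddCommGroup Z] [InnerProductSpace ℝ Z]
    (u z : Z) :
    theta ω ‖u + z‖ + theta ω ‖u - z‖ - 2 * theta ω ‖u‖ ≤ 2 * (‖z‖ * ω ‖z‖) := by
  have hc := hω.concaveOn_theta_sqrt
  have hsq : ∀ x : Z, theta ω ‖x‖ = theta ω √(‖x‖ ^ 2) := fun x => by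
    rw [Real.sqrt_sq (norm_nonneg x)]
  have hpar : ‖u + z‖ ^ 2 + ‖u - z‖ ^ 2 = 2 * (‖u‖ ^ 2 + ‖z‖ ^ 2) := by
    have := parallelogram_law_with_norm ℝ u z
    nlinarith
  have h1 := hc.2 (show ‖u + z‖ ^ 2 ∈ Ici 0 from mem_Ici.2 (by positivity))
    (show ‖u - z‖ ^ 2 ∈ Ici 0 from mem_Ici.2 (by positivity))
    (show (0 : ℝ) ≤ 1 / 2 by norm_num) (show (0 : ℝ) ≤ 1 / 2 by norm_num) (by norm_num)
  -- By the parallelogram law the midpoint of `‖u + z‖²` and `‖u - z‖²` is `‖u‖² + ‖z‖²`.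
  have e1 : (1 / 2 : ℝ) * ‖u + z‖ ^ 2 + 1 / 2 * ‖u - z‖ ^ 2 = ‖u‖ ^ 2 + ‖z‖ ^ 2 := by linarith
  simp only [smul_eq_mul] at h1
  rw [e1, ← hsq, ← hsq] at h1
  -- subadditivity of `t ↦ θ(√t)`
  have h2 : theta ω √(‖u‖ ^ 2 + ‖z‖ ^ 2) ≤ theta ω ‖u‖ + theta ω ‖z‖ := by
    rcases eq_or_ne z 0 with rfl | hz
    · simp [theta_zero, Real.sqrt_sq]
    have hp : 0 < ‖u‖ ^ 2 + ‖z‖ ^ 2 := by positivity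
    have key : ∀ r : ℝ, 0 ≤ r → r ≤ ‖u‖ ^ 2 + ‖z‖ ^ 2 →
        r / (‖u‖ ^ 2 + ‖z‖ ^ 2) * theta ω √(‖u‖ ^ 2 + ‖z‖ ^ 2) ≤ theta ω √r := by
      intro r hr hr'
      have h := hc.2 (show (0 : ℝ) ∈ Ici 0 from self_mem_Ici)
        (show ‖u‖ ^ 2 + ‖z‖ ^ 2 ∈ Ici 0 from hp.le)
        (show (0 : ℝ) ≤ 1 - r / (‖u‖ ^ 2 + ‖z‖ ^ 2) by rwa [sub_nonneg, div_le_one hp])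
        (show (0 : ℝ) ≤ r / (‖u‖ ^ 2 + ‖z‖ ^ 2) by positivity) (by ring)
      simpa only [smul_eq_mul, mul_zero, zero_add, div_mul_cancel₀ _ hp.ne', Real.sqrt_zero,
        theta_zero] using h
    have k1 := key (‖u‖ ^ 2) (by positivity) (le_add_of_nonneg_right (by positivity))
    have k2 := key (‖z‖ ^ 2) (by positivity) (le_add_of_nonneg_left (by positivity))
    rw [← hsq] at k1 k2
    have k3 : ‖u‖ ^ 2 / (‖u‖ ^ 2 + ‖z‖ ^ 2) + ‖z‖ ^ 2 / (‖u‖ ^ 2 + ‖z‖ ^ 2) = 1 := by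
      rw [← add_div, div_self hp.ne']
    calc _ = (‖u‖ ^ 2 / (‖u‖ ^ 2 + ‖z‖ ^ 2) + ‖z‖ ^ 2 / (‖u‖ ^ 2 + ‖z‖ ^ 2)) *
          theta ω √(‖u‖ ^ 2 + ‖z‖ ^ 2) := by rw [k3, one_mul]
      _ ≤ _ := by rw [add_mul]; exact add_le_add k1 k2
  have h3 := hω.theta_le_mul (norm_nonneg z)
  linarith

end IsModulus

/-! ### Subgradients, semiconcavity and regularity of convex functions. -/

section Convex

variable {Z : Type*} [NormedAddCommGroup Z] [InnerProductSpace ℝ Z]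

/-- A real convex function on a finite-dimensional space has a subgradient at every point. -/
theorem exists_subgradient [FiniteDimensional ℝ Z] {C : Z → ℝ} (hC : ConvexOn ℝ univ C) (x : Z) :
    ∃ p : Z, ∀ y, C x + inner ℝ p (y - x) ≤ C y := by
  have hcont : Continuous C := by
    rw [← continuousOn_univ]; exact hC.continuousOn isOpen_univ
  have hconv : Convex ℝ {q : Z × ℝ | C q.1 < q.2} := by simpa using hC.convex_strict_epigraph
  have hopen : IsOpen {q : Z × ℝ | C q.1 < q.2} :=
    isOpen_lt (hcont.comp continuous_fst) continuous_snd
  -- The functional separating `(x, C x)` from the strict epigraph is negative on `(0, 1)`, hence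
  -- not vertical; dividing by `b` turns it into a supporting affine function.
  obtain ⟨L, hL⟩ := geometric_hahn_banach_open_point hconv hopen
    (show (x, C x) ∉ {q : Z × ℝ | C q.1 < q.2} by simp)
  have hsplit : ∀ y t, L (y, t) = L (y, 0) + t * L (0, 1) := fun y t => by
    rw [← smul_eq_mul, ← map_smul, ← map_add]; simp
  set b := -L (0, 1) with hb
  have hb0 : 0 < b := by
    have h := hL (x, C x + 1) (by simp)
    rw [hsplit, hsplit x (C x)] at h
    linarith
  have hle : ∀ y, L (y, 0) - C y * b ≤ L (x, 0) - C x * b := by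
    intro y
    refine le_of_forall_pos_lt_add fun ε hε => ?_
    have h := hL (y, C y + ε / b) (by simp; positivity)
    rw [hsplit, hsplit x (C x)] at h
    have e : ε / b * b = ε := div_mul_cancel₀ _ hb0.ne'
    nlinarith
  refine ⟨(InnerProductSpace.toDual ℝ Z).symm (b⁻¹ • L.comp (ContinuousLinearMap.inl ℝ Z ℝ)),
    fun y => ?_⟩
  rw [InnerProductSpace.toDual_symm_apply]
  have h := hle y
  have e : L (y - x, 0) = L (y, 0) - L (x, 0) := by rw [← map_sub]; simp
  simp only [smul_apply, ContinuousLinearMap.comp_apply,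
    ContinuousLinearMap.inl_apply, smul_eq_mul, e]
  have : b⁻¹ * (L (y, 0) - L (x, 0)) ≤ C y - C x := by
    rw [inv_mul_le_iff₀ hb0]; linarith
  linarith

theorem hasDerivAt_comp_line [CompleteSpace Z] {φ : Z → ℝ} {p x z : Z} {s : ℝ}
    (h : HasGradientAt φ p (x + s • z)) :
    HasDerivAt (fun s : ℝ => φ (x + s • z)) (inner ℝ p z) s := by
  have h1 : HasDerivAt (fun s : ℝ => x + s • z) z s := by
    simpa using ((hasDerivAt_id s).smul_const z).const_add x
  have h2 := h.hasFDerivAt.comp_hasDerivAt s h1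
  simpa using! h2

/-- A gradient of a convex function is a subgradient. -/
theorem inner_gradient_le [CompleteSpace Z] {C : Z → ℝ} (hC : ConvexOn ℝ univ C) {p x : Z}
    (h : HasGradientAt C p x) (y : Z) : C x + inner ℝ p (y - x) ≤ C y := by
  have hc : ConvexOn ℝ univ fun s : ℝ => C (x + s • (y - x)) := by
    have := hC.comp_affineMap (AffineMap.lineMap x y : ℝ →ᵃ[ℝ] Z)
    simpa [Function.comp_def, AffineMap.lineMap_apply, add_comm] using this
  have hd := hasDerivAt_comp_line (φ := C) (x := x) (z := y - x) (s := 0) (p := p) (by simpa using h)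
  have := hc.le_slope_of_hasDerivAt (mem_univ 0) (mem_univ 1) one_pos hd
  simp [slope_def_field] at this
  linarith

/-- Local semiconcavity with modulus `t ω(t)`. -/
def LocSemiconcave (ω : ℝ → ℝ) (h : Z → ℝ) : Prop :=
  ∀ R : ℝ, 0 < R → ∃ M : ℝ, 0 ≤ M ∧ ∀ x z : Z, ‖x‖ ≤ R → ‖z‖ ≤ R →
    h (x + z) + h (x - z) - 2 * h x ≤ M * (‖z‖ * ω ‖z‖)

/-- A bound for the oscillation of the gradient on a ball implies a bound for the second
differences. -/
theorem add_sub_le_of_gradient [CompleteSpace Z] {ω : ℝ → ℝ} (hω : IsModulus ω) {φ : Z → ℝ}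
    (hφ : Differentiable ℝ φ) {R M : ℝ} (hM : 0 ≤ M)
    (h : ∀ u v : Z, ‖u‖ ≤ 2 * R → ‖v‖ ≤ 2 * R → u ≠ v →
      ‖gradient φ u - gradient φ v‖ / ω ‖u - v‖ ≤ M)
    {x z : Z} (hx : ‖x‖ ≤ R) (hz : ‖z‖ ≤ R) :
    φ (x + z) + φ (x - z) - 2 * φ x ≤ 2 * M * (‖z‖ * ω ‖z‖) := by
  have hd : ∀ s : ℝ, HasDerivAt (fun s : ℝ => φ (x + s • z) + φ (x + s • (-z)))
      (inner ℝ (gradient φ (x + s • z)) z + inner ℝ (gradient φ (x + s • (-z))) (-z)) s :=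
    fun s => (hasDerivAt_comp_line (hφ _).hasGradientAt).add
      (hasDerivAt_comp_line (hφ _).hasGradientAt)
  -- Mean value theorem on `[0, 1]` for the symmetrized function, whose slope there is the second
  -- difference itself.
  obtain ⟨s, hs, he⟩ := exists_hasDerivAt_eq_slope _ _ (zero_lt_one' ℝ)
    (fun s _ => (hd s).continuousAt.continuousWithinAt) (fun s _ => hd s)
  have hn : ‖s • z‖ ≤ ‖z‖ := by
    rw [norm_smul, Real.norm_of_nonneg hs.1.le]
    exact mul_le_of_le_one_left (norm_nonneg z) hs.2.le
  have hb : ‖gradient φ (x + s • z) - gradient φ (x + s • (-z))‖ ≤ M * (2 * ω ‖z‖) := by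
    have hω0 := hω.nonneg (norm_nonneg z)
    by_cases hne : x + s • z = x + s • (-z)
    · rw [hne, sub_self, norm_zero]; positivity
    have hn2 : ‖x + s • z - (x + s • (-z))‖ ≤ 2 * ‖z‖ := by
      have : x + s • z - (x + s • (-z)) = s • z + s • z := by rw [smul_neg]; abel
      rw [this]
      linarith [norm_add_le (s • z) (s • z)]
    have h1 := h (x + s • z) (x + s • (-z))
      ((norm_add_le _ _).trans (by linarith))
      ((norm_add_le _ _).trans (by rw [smul_neg, norm_neg]; linarith)) hne
    rw [div_le_iff₀ (hω.pos (norm_pos_iff.2 (sub_ne_zero.2 hne)))] at h1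
    refine h1.trans (mul_le_mul_of_nonneg_left ?_ hM)
    exact (hω.mono (norm_nonneg _) hn2).trans (hω.two_mul_le (norm_nonneg z))
  have hi : inner ℝ (gradient φ (x + s • z)) z + inner ℝ (gradient φ (x + s • (-z))) (-z)
      ≤ M * (2 * ω ‖z‖) * ‖z‖ := by
    rw [inner_neg_right, ← sub_eq_add_neg, ← inner_sub_left]
    exact (real_inner_le_norm _ _).trans (mul_le_mul_of_nonneg_right hb (norm_nonneg z))
  rw [he] at hi
  simp only [one_smul, zero_smul, add_zero, sub_zero, div_one, ← sub_eq_add_neg] at hi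
  linarith

/-- A convex function which is locally semiconcave is of class `C^{1,ω}_loc`. -/
theorem isC1OmegaLoc_of_locSemiconcave [FiniteDimensional ℝ Z] {ω : ℝ → ℝ} (hω : IsModulus ω) {C : Z → ℝ}
    (hC : ConvexOn ℝ univ C) (hs : LocSemiconcave ω C) : IsC1OmegaLoc ω C := by
  choose p hp using exists_subgradient hC
  -- The subgradient inequality at `x - z` removes `C (x - z)`, so `C` is trapped between its
  -- supporting affine function and the same function plus `M ‖z‖ ω ‖z‖`; differentiability follows.
  have upper : ∀ R M : ℝ, (∀ x z : Z, ‖x‖ ≤ R → ‖z‖ ≤ R →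
      C (x + z) + C (x - z) - 2 * C x ≤ M * (‖z‖ * ω ‖z‖)) → ∀ x z : Z, ‖x‖ ≤ R → ‖z‖ ≤ R →
      C (x + z) ≤ C x + inner ℝ (p x) z + M * (‖z‖ * ω ‖z‖) := by
    intro R M h x z hx hz
    have h1 := h x z hx hz
    have h2 := hp x (x - z)
    rw [show x - z - x = -z by abel, inner_neg_right] at h2
    linarith
  have hgrad : ∀ x, HasGradientAt C (p x) x := by
    intro x
    rw [hasGradientAt_iff_isLittleO_nhds_zero]
    obtain ⟨M, hM0, hM⟩ := hs (‖x‖ + 1) (by positivity)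
    have ht : Tendsto (fun z : Z => M * ω ‖z‖) (𝓝 0) (𝓝 0) := by
      have h1 : Continuous fun z : Z => M * ω (max ‖z‖ 0) :=
        continuous_const.mul (hω.continuous_max.comp continuous_norm)
      have h2 := h1.tendsto 0
      simpa [hω.map_zero] using h2
    rw [Asymptotics.isLittleO_iff]
    intro c hc
    filter_upwards [ht.eventually (gt_mem_nhds hc), Metric.ball_mem_nhds (0 : Z) one_pos]
      with z hz hz1
    have hz1 : ‖z‖ ≤ ‖x‖ + 1 := by
      have : ‖z‖ < 1 := by simpa using hz1
      linarith [norm_nonneg x]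
    have h1 := upper _ _ hM x z (by linarith) hz1
    have h2 := hp x (x + z)
    rw [add_sub_cancel_left] at h2
    rw [Real.norm_eq_abs, abs_of_nonneg (by linarith)]
    have h3 : M * (‖z‖ * ω ‖z‖) ≤ c * ‖z‖ := by
      rw [mul_left_comm, mul_comm]
      exact mul_le_mul_of_nonneg_right hz.le (norm_nonneg z)
    linarith
  refine ⟨fun x => (hgrad x).differentiableAt, fun R hR => ?_⟩
  -- The bound is applied at `y` with increment `x - y + z`, of norm at most `2‖x - y‖ ≤ 4R`.
  obtain ⟨M, hM0, hM⟩ := hs (4 * R) (by positivity)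
  refine ⟨4 * M, fun x y hx hy hxy => ?_⟩
  rw [(hgrad x).gradient, (hgrad y).gradient]
  have hr : 0 < ‖x - y‖ := norm_pos_iff.2 (sub_ne_zero.2 hxy)
  rw [div_le_iff₀ (hω.pos hr)]
  rcases eq_or_ne (p x) (p y) with he | he
  · rw [he, sub_self, norm_zero]
    exact mul_nonneg (by positivity) (hω.nonneg hr.le)
  have hd : 0 < ‖p x - p y‖ := norm_pos_iff.2 (sub_ne_zero.2 he)
  set r := ‖x - y‖ with hr_def
  -- Pointing along `p x - p y` with length `‖x - y‖`, this `z` detects the full norm of the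
  -- gradient difference. Comparing at `x + z` the upper bound from `y` with the lower bound from
  -- `x` then controls that norm.
  set z : Z := (r / ‖p x - p y‖) • (p x - p y) with hz_def
  have hz : ‖z‖ = r := by
    rw [hz_def, norm_smul, Real.norm_of_nonneg (by positivity), div_mul_cancel₀ _ hd.ne']
  have hin : inner ℝ (p x - p y) z = r * ‖p x - p y‖ := by
    rw [hz_def, inner_smul_right, real_inner_self_eq_norm_sq]
    field_simp
  have hr2 : r ≤ 2 * R := (norm_sub_le x y).trans (by linarith)
  have hn : ‖x - y + z‖ ≤ 2 * r := (norm_add_le _ _).trans (by rw [hz]; linarith)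
  have h1 := upper _ _ hM y (x - y + z) (by linarith) (by linarith)
  have h2 := hp x (x + z)
  have h3 := hp y x
  rw [show y + (x - y + z) = x + z by abel, inner_add_right] at h1
  rw [add_sub_cancel_left] at h2
  rw [inner_sub_left] at hin
  have h4 : ‖x - y + z‖ * ω ‖x - y + z‖ ≤ (2 * r) * (2 * ω r) :=
    mul_le_mul hn ((hω.mono (norm_nonneg _) hn).trans (hω.two_mul_le hr.le))
      (hω.nonneg (norm_nonneg _)) (by positivity)
  have h5 : r * ‖p x - p y‖ ≤ r * (4 * M * ω r) := by
    have := mul_le_mul_of_nonneg_left h4 hM0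
    linarith
  exact le_of_mul_le_mul_left h5 hr

end Convex

/-! ### Convex envelopes and their semiconcavity. -/

section Envelope

variable {Z : Type*} [NormedAddCommGroup Z] [InnerProductSpace ℝ Z]

/-- The convex envelope of `h`, obtained from the convex hull of the epigraph of `h`. -/
noncomputable def convEnv (h : Z → ℝ) (x : Z) : ℝ :=
  sInf {t : ℝ | (x, t) ∈ convexHull ℝ {q : Z × ℝ | h q.1 ≤ q.2}}

theorem le_of_mem_convexHull_epigraph {h ψ : Z → ℝ} (hψ : ConvexOn ℝ univ ψ) (hle : ∀ z, ψ z ≤ h z)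
    {x : Z} {t : ℝ} (hx : (x, t) ∈ convexHull ℝ {q : Z × ℝ | h q.1 ≤ q.2}) : ψ x ≤ t := by
  have hconv : Convex ℝ {q : Z × ℝ | ψ q.1 ≤ q.2} := by simpa using hψ.convex_epigraph
  exact convexHull_min (fun q hq => (hle q.1).trans hq) hconv hx

theorem mem_convexHull_epigraph (h : Z → ℝ) (x : Z) :
    (x, h x) ∈ convexHull ℝ {q : Z × ℝ | h q.1 ≤ q.2} :=
  subset_convexHull ℝ _ (by simp)

theorem le_convEnv {h ψ : Z → ℝ} (hψ : ConvexOn ℝ univ ψ) (hle : ∀ z, ψ z ≤ h z) (x : Z) :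
    ψ x ≤ convEnv h x :=
  le_csInf ⟨_, mem_convexHull_epigraph h x⟩ fun _ ht => le_of_mem_convexHull_epigraph hψ hle ht

/-- The convex minorant `ψ` bounds from below the set whose infimum is taken; without it `sInf`
could return its default value `0`. -/
theorem convEnv_le_of_mem {h ψ : Z → ℝ} (hψ : ConvexOn ℝ univ ψ) (hle : ∀ z, ψ z ≤ h z)
    {x : Z} {t : ℝ} (hx : (x, t) ∈ convexHull ℝ {q : Z × ℝ | h q.1 ≤ q.2}) : convEnv h x ≤ t :=
  csInf_le ⟨ψ x, fun _ ht => le_of_mem_convexHull_epigraph hψ hle ht⟩ hx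

theorem convEnv_le {h ψ : Z → ℝ} (hψ : ConvexOn ℝ univ ψ) (hle : ∀ z, ψ z ≤ h z) (x : Z) :
    convEnv h x ≤ h x :=
  convEnv_le_of_mem hψ hle (mem_convexHull_epigraph h x)

theorem exists_mem_lt_convEnv_add (h : Z → ℝ) (x : Z) {ε : ℝ} (hε : 0 < ε) :
    ∃ t, (x, t) ∈ convexHull ℝ {q : Z × ℝ | h q.1 ≤ q.2} ∧ t < convEnv h x + ε :=
  Real.lt_sInf_add_pos ⟨_, mem_convexHull_epigraph h x⟩ hε

theorem convexOn_convEnv {h ψ : Z → ℝ} (hψ : ConvexOn ℝ univ ψ) (hle : ∀ z, ψ z ≤ h z) :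
    ConvexOn ℝ univ (convEnv h) := by
  refine ⟨convex_univ, fun x _ y _ a b ha hb hab => le_of_forall_pos_le_add fun ε hε => ?_⟩
  obtain ⟨t, ht, ht'⟩ := exists_mem_lt_convEnv_add h x hε
  obtain ⟨r, hr, hr'⟩ := exists_mem_lt_convEnv_add h y hε
  have := convEnv_le_of_mem hψ hle (convex_convexHull ℝ _ ht hr ha hb hab)
  replace this : convEnv h (a • x + b • y) ≤ a * t + b * r := this
  simp only [smul_eq_mul]
  have h1 := mul_le_mul_of_nonneg_left ht'.le ha
  have h2 := mul_le_mul_of_nonneg_left hr'.le hb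
  have h3 : a * (convEnv h x + ε) + b * (convEnv h y + ε) =
      a * convEnv h x + b * convEnv h y + (a + b) * ε := by ring
  rw [hab, one_mul] at h3
  linarith

/-- Almost optimal convex combinations for the convex envelope. -/
theorem exists_combination (h : Z → ℝ) (x : Z) {ε : ℝ} (hε : 0 < ε) :
    ∃ (κ : Type) (_ : Fintype κ) (w : κ → ℝ) (y : κ → Z), (∀ i, 0 ≤ w i) ∧ ∑ i, w i = 1 ∧
      ∑ i, w i • y i = x ∧ ∑ i, w i * h (y i) ≤ convEnv h x + ε := by
  obtain ⟨t, ht, ht'⟩ := exists_mem_lt_convEnv_add h x hε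
  obtain ⟨κ, _, w, y, hw, hw1, hy, hsum⟩ := mem_convexHull_iff_exists_fintype.1 ht
  refine ⟨κ, inferInstance, w, fun i => (y i).1, hw, hw1, ?_, ?_⟩
  · simpa [Prod.fst_sum] using congrArg Prod.fst hsum
  · have h2 : ∑ i, w i * (y i).2 = t := by simpa [Prod.snd_sum] using congrArg Prod.snd hsum
    calc ∑ i, w i * h (y i).1 ≤ ∑ i, w i * (y i).2 :=
          Finset.sum_le_sum fun i _ => mul_le_mul_of_nonneg_left (hy i) (hw i)
      _ ≤ _ := by linarith

/-- Functions of this form are the minorants of `h`: they keep the envelope finite and carry its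
coercivity. -/
theorem convexOn_inner_add_mul_norm_sub (p : Z) {c : ℝ} (hc : 0 ≤ c) (K : ℝ) :
    ConvexOn ℝ univ fun x : Z => inner ℝ p x + c * ‖x‖ - K := by
  have h1 : ConvexOn ℝ univ fun x : Z => inner ℝ p x :=
    (innerₛₗ ℝ p).convexOn convex_univ
  have h2 : ConvexOn ℝ univ fun x : Z => c * ‖x‖ := by
    simpa using (convexOn_norm convex_univ : ConvexOn ℝ univ (norm : Z → ℝ)).smul hc
  exact ((h1.add h2).add_const (-K)).congr fun x _ => (sub_eq_add_neg _ K).symm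

theorem convexOn_affine (r : ℝ) (η q : Z) : ConvexOn ℝ univ fun u : Z => r + inner ℝ η (u - q) := by
  have h := ((innerₛₗ ℝ η).convexOn (convex_univ : Convex ℝ (univ : Set Z))).add_const
    (r - inner ℝ η q)
  refine h.congr fun u _ => ?_
  simp [inner_sub_right]
  ring

theorem sub_mem_diffSpan {ι : Type*} (η : ι → Z) (i j : ι) : η i - η j ∈ diffSpan η :=
  Submodule.subset_span ⟨i, j, rfl⟩

/-- The convex envelope of a coercive, locally semiconcave function is locally semiconcave: in an
almost optimal convex combination the points far away carry at most half of the total weight,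
and only the remaining points need to be moved. -/
theorem LocSemiconcave.convEnv [FiniteDimensional ℝ Z] {ω : ℝ → ℝ} (hω : IsModulus ω) {h : Z → ℝ}
    (hs : LocSemiconcave ω h) {p : Z} {c K : ℝ} (hc : 0 < c)
    (hb : ∀ x, inner ℝ p x + c * ‖x‖ - K ≤ h x) : LocSemiconcave ω (convEnv h) := by
  have hψ := convexOn_inner_add_mul_norm_sub p hc.le K
  have hC := convexOn_convEnv hψ hb
  intro R hR
  have hcont : Continuous (ConvexJet.convEnv h) := by
    rw [← continuousOn_univ]; exact hC.continuousOn isOpen_univ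
  obtain ⟨B, hB⟩ := (isCompact_closedBall (0 : Z) R).bddAbove_image
    (f := fun x => ConvexJet.convEnv h x - inner ℝ p x + K + 1) (by fun_prop)
  replace hB : ∀ x : Z, ‖x‖ ≤ R → ConvexJet.convEnv h x - inner ℝ p x + K + 1 ≤ B := fun x hx =>
    hB ⟨x, by simpa using hx, rfl⟩
  have hB0 : 0 < B := by
    have h1 := hB 0 (by simpa using hR.le)
    have h2 := le_convEnv hψ hb 0
    simp only [inner_zero_right, norm_zero, mul_zero] at h1 h2
    linarith
  -- In an almost optimal combination for `x` the weighted mean of `c‖y i‖` is at most `B`, so by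
  -- Markov's inequality points with `c‖y i‖ > 2B` carry weight at most `1/2`.
  set ρ := 2 * B / c with hρ
  obtain ⟨M, hM0, hM⟩ := hs (max ρ (2 * R)) (lt_max_of_lt_right (by positivity))
  refine ⟨4 * M, by positivity, fun x z hx hz => le_of_forall_pos_le_add fun ε hε => ?_⟩
  -- The bound `1` keeps `B` independent of `ε`; the bound `ε / 2` is spent twice, since the
  -- combination is used for both `x + z` and `x - z`.
  obtain ⟨κ, _, w, y, hw, hw1, hwx, hwh⟩ := exists_combination h x
    (show 0 < min 1 (ε / 2) by positivity)
  classical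
  let N : κ → Prop := fun i => ‖y i‖ ≤ ρ
  set Λ := ∑ i, if N i then w i else 0 with hΛ
  -- the far points have small weight
  have hΛ2 : 1 / 2 ≤ Λ := by
    have e1 : ∑ i, w i * (c * ‖y i‖) ≤ B := by
      have e2 : ∑ i, w i * (inner ℝ p (y i) + c * ‖y i‖ - K) ≤ ConvexJet.convEnv h x + 1 :=
        (Finset.sum_le_sum fun i _ => mul_le_mul_of_nonneg_left (hb (y i)) (hw i)).trans
          (hwh.trans (by gcongr; exact min_le_left _ _))
      have e3 : ∑ i, w i * inner ℝ p (y i) = inner ℝ p x := by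
        rw [← hwx, inner_sum]; simp only [inner_smul_right]
      have e4 : ∑ i, w i * (inner ℝ p (y i) + c * ‖y i‖ - K) =
          ∑ i, w i * inner ℝ p (y i) + ∑ i, w i * (c * ‖y i‖) - K := by
        simp only [mul_sub, mul_add, Finset.sum_sub_distrib, Finset.sum_add_distrib,
          ← Finset.sum_mul, hw1, one_mul]
      have := hB x hx
      linarith
    have e5 : (1 - Λ) * (2 * B) ≤ B := by
      refine le_trans ?_ e1
      rw [hΛ, ← hw1, ← Finset.sum_sub_distrib, Finset.sum_mul]
      refine Finset.sum_le_sum fun i _ => ?_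
      split_ifs with hi
      · simpa using mul_nonneg (hw i) (mul_nonneg hc.le (norm_nonneg _))
      · have : 2 * B ≤ c * ‖y i‖ := by
          have h6 : 2 * B / c < ‖y i‖ := not_le.1 hi
          rw [div_lt_iff₀ hc] at h6
          linarith
        simpa using mul_le_mul_of_nonneg_left this (hw i)
    nlinarith
  have hΛ0 : 0 < Λ := by linarith
  -- moving the near points
  have move : ∀ v : Z, ConvexJet.convEnv h (x + v) ≤
      ∑ i, w i * h (if N i then y i + Λ⁻¹ • v else y i) := by
    intro v
    have e1 : ∑ i, w i • (if N i then y i + Λ⁻¹ • v else y i) = x + v := by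
      have : ∀ i, w i • (if N i then y i + Λ⁻¹ • v else y i) =
          w i • y i + (if N i then w i else 0) • Λ⁻¹ • v := by
        intro i; split_ifs <;> simp
      simp only [this, Finset.sum_add_distrib, hwx, ← Finset.sum_smul]
      rw [← hΛ, smul_smul, mul_inv_cancel₀ hΛ0.ne', one_smul]
    rw [← e1]
    refine (hC.map_sum_le (fun i _ => hw i) hw1 fun i _ => mem_univ _).trans ?_
    exact Finset.sum_le_sum fun i _ =>
      mul_le_mul_of_nonneg_left (convEnv_le hψ hb _) (hw i)
  have hΛi : Λ⁻¹ ≤ 2 := by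
    rw [inv_le_comm₀ hΛ0 two_pos]; simpa using hΛ2
  have hn : ‖Λ⁻¹ • z‖ ≤ 2 * ‖z‖ := by
    rw [norm_smul, Real.norm_of_nonneg (by positivity)]
    gcongr
  have hsec : ∀ i, N i → h (y i + Λ⁻¹ • z) + h (y i - Λ⁻¹ • z) - 2 * h (y i) ≤
      4 * M * (‖z‖ * ω ‖z‖) := by
    intro i hi
    refine (hM (y i) (Λ⁻¹ • z) (hi.trans (le_max_left _ _))
      (hn.trans (le_max_of_le_right (by linarith)))).trans ?_
    have : ‖Λ⁻¹ • z‖ * ω ‖Λ⁻¹ • z‖ ≤ (2 * ‖z‖) * (2 * ω ‖z‖) :=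
      mul_le_mul hn ((hω.mono (norm_nonneg _) hn).trans (hω.two_mul_le (norm_nonneg z)))
        (hω.nonneg (norm_nonneg _)) (by positivity)
    calc _ ≤ M * ((2 * ‖z‖) * (2 * ω ‖z‖)) := mul_le_mul_of_nonneg_left this hM0
      _ = _ := by ring
  have h1 := move z
  have h2 := move (-z)
  rw [← sub_eq_add_neg] at h2
  have h3 : ∑ i, w i * h (if N i then y i + Λ⁻¹ • z else y i) +
      ∑ i, w i * h (if N i then y i + Λ⁻¹ • (-z) else y i) ≤
      2 * ∑ i, w i * h (y i) + 4 * M * (‖z‖ * ω ‖z‖) := by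
    have e : 2 * ∑ i, w i * h (y i) + 4 * M * (‖z‖ * ω ‖z‖) =
        ∑ i, w i * (2 * h (y i) + 4 * M * (‖z‖ * ω ‖z‖)) := by
      simp only [mul_add, Finset.sum_add_distrib, ← Finset.sum_mul, hw1, one_mul, Finset.mul_sum,
        mul_left_comm (2 : ℝ)]
    rw [e, ← Finset.sum_add_distrib]
    refine Finset.sum_le_sum fun i _ => ?_
    rw [← mul_add]
    refine mul_le_mul_of_nonneg_left ?_ (hw i)
    split_ifs with hi
    · have := hsec i hi
      rw [smul_neg, ← sub_eq_add_neg]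
      linarith
    · have : 0 ≤ 4 * M * (‖z‖ * ω ‖z‖) := by
        have := hω.nonneg (norm_nonneg z)
        positivity
      linarith
  have h4 : min 1 (ε / 2) ≤ ε / 2 := min_le_right _ _
  linarith

end Envelope

/-! ### Extension of a jet whose slopes affinely span the space. -/

section Jet

variable {Z : Type*} [NormedAddCommGroup Z] [InnerProductSpace ℝ Z] [FiniteDimensional ℝ Z]
  {ι : Type*} [Nonempty ι]

/-- If the slopes of a family of affine functions affinely span the space, then the supremum of the
family is coercive up to a linear function. -/
theorem exists_coercive_bound (s : ι → ℝ) (η q : ι → Z) (hη : diffSpan η = ⊤) :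
    ∃ (p : Z) (c K : ℝ), 0 < c ∧ ∀ u y, (∀ j, s j + inner ℝ (η j) (u - q j) ≤ y) →
      inner ℝ p u + c * ‖u‖ - K ≤ y := by
  -- `D` consists of the slopes of affine minorants of the supremum, phrased through upper bounds
  -- `y` so that the supremum need not be finite. It is convex and contains every `η j`, so it has
  -- an interior point; the slopes around that point provide the growth in every direction.
  let D : Set Z := {p | ∃ K : ℝ, ∀ u y, (∀ j, s j + inner ℝ (η j) (u - q j) ≤ y) →
    inner ℝ p u - K ≤ y}
  have hD : Convex ℝ D := by
    rintro p₁ ⟨K₁, h₁⟩ p₂ ⟨K₂, h₂⟩ a b ha hb hab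
    refine ⟨a * K₁ + b * K₂, fun u y hy => ?_⟩
    have e1 := mul_le_mul_of_nonneg_left (h₁ u y hy) ha
    have e2 := mul_le_mul_of_nonneg_left (h₂ u y hy) hb
    have e3 : a * y + b * y = y := by rw [← add_mul, hab, one_mul]
    rw [inner_add_left, real_inner_smul_left, real_inner_smul_left]
    linarith
  have hηD : range η ⊆ D := by
    rintro _ ⟨j, rfl⟩
    refine ⟨inner ℝ (η j) (q j) - s j, fun u y hy => ?_⟩
    have := hy j
    rw [inner_sub_right] at this
    linarith
  have hspan : affineSpan ℝ (range η) = ⊤ := by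
    rw [AffineSubspace.affineSpan_eq_top_iff_vectorSpan_eq_top_of_nonempty _ _ _
      (range_nonempty η), vectorSpan_def, ← top_le_iff, ← hη]
    refine Submodule.span_mono ?_
    rintro _ ⟨i, j, rfl⟩
    exact ⟨η i, ⟨i, rfl⟩, η j, ⟨j, rfl⟩, rfl⟩
  obtain ⟨p, hp⟩ := (interior_convexHull_nonempty_iff_affineSpan_eq_top.2 hspan).mono
    (interior_mono (convexHull_min hηD hD))
  obtain ⟨ε, hε, hball⟩ := Metric.mem_nhds_iff.1 (mem_interior_iff_mem_nhds.1 hp)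
  let e := stdOrthonormalBasis ℝ Z
  have hmem : ∀ (v : Z), ‖v‖ < ε → p + v ∈ D := fun v hv => hball (by simpa using hv)
  have hn : ∀ k, ‖(ε / 2) • e k‖ < ε := fun k => by
    rw [norm_smul, e.norm_eq_one, Real.norm_of_nonneg (by positivity)]; linarith
  obtain ⟨K₀, hK₀⟩ : p ∈ D := by simpa using hmem 0 (by simpa using hε)
  choose K₁ hK₁ using fun k => hmem ((ε / 2) • e k) (hn k)
  choose K₂ hK₂ using fun k => hmem (-((ε / 2) • e k)) (by rw [norm_neg]; exact hn k)
  let K := |K₀| + ∑ k, (|K₁ k| + |K₂ k|)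
  have hKk : ∀ k, |K₁ k| + |K₂ k| ≤ K := fun k =>
    (Finset.single_le_sum (f := fun k => |K₁ k| + |K₂ k|) (fun k _ => by positivity)
      (Finset.mem_univ k)).trans (le_add_of_nonneg_left (abs_nonneg _))
  have hKz : K₀ ≤ K := (le_abs_self K₀).trans (le_add_of_nonneg_right (by positivity))
  -- Summing the coordinate bounds costs a factor `finrank`; the `+ 1` keeps the denominator
  -- positive when the space is trivial.
  refine ⟨p, ε / 2 / (Module.finrank ℝ Z + 1), K, by positivity, fun u y hy => ?_⟩
  have hY : 0 ≤ y - inner ℝ p u + K := by linarith [hK₀ u y hy]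
  have hcoord : ∀ k, ε / 2 * ‖inner ℝ (e k) u‖ ≤ y - inner ℝ p u + K := by
    intro k
    have h1 := hK₁ k u y hy
    have h2 := hK₂ k u y hy
    rw [inner_add_left, real_inner_smul_left] at h1
    rw [inner_add_left, inner_neg_left, real_inner_smul_left] at h2
    have h3 := hKk k
    rw [Real.norm_eq_abs]
    rcases abs_cases (inner ℝ (e k) u) with ⟨h, _⟩ | ⟨h, _⟩ <;> rw [h] <;>
      linarith [le_abs_self (K₁ k), le_abs_self (K₂ k), abs_nonneg (K₁ k), abs_nonneg (K₂ k)]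
  have hnorm : ‖u‖ ≤ ∑ k, ‖inner ℝ (e k) u‖ := by
    conv_lhs => rw [← e.sum_repr' u]
    refine (norm_sum_le _ _).trans (Finset.sum_le_sum fun k _ => ?_)
    rw [norm_smul, e.norm_eq_one, mul_one]
  have hsum : ε / 2 * ‖u‖ ≤ Module.finrank ℝ Z * (y - inner ℝ p u + K) := by
    calc ε / 2 * ‖u‖ ≤ ∑ k, ε / 2 * ‖inner ℝ (e k) u‖ := by
          rw [← Finset.mul_sum]; gcongr
      _ ≤ ∑ _k : Fin (Module.finrank ℝ Z), (y - inner ℝ p u + K) :=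
          Finset.sum_le_sum fun k _ => hcoord k
      _ = _ := by rw [Finset.sum_const, Finset.card_univ, Fintype.card_fin, nsmul_eq_mul]
  have hfin : ε / 2 / (Module.finrank ℝ Z + 1) * ‖u‖ ≤ y - inner ℝ p u + K := by
    rw [div_mul_eq_mul_div, div_le_iff₀ (by positivity)]
    linarith
  linarith

/-- The infimum of a family of functions `ℓ_i + φ_i + a θ(|· - q_i|)` is locally semiconcave. -/
theorem locSemiconcave_of_isGLB {ω : ℝ → ℝ} (hω : IsModulus ω) {s : ι → ℝ} {η q : ι → Z}
    {φ : ι → Z → ℝ} {a : ℝ} (ha : 0 < a) (hd : ∀ i, Differentiable ℝ (φ i))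
    (hu : ∀ R : ℝ, 0 < R → ∃ M : ℝ, ∀ (i : ι) (u v : Z), ‖q i‖ ≤ R → ‖u‖ ≤ R → ‖v‖ ≤ R → u ≠ v →
      ‖gradient (φ i) u - gradient (φ i) v‖ / ω ‖u - v‖ ≤ M)
    (ht : ∀ i j u, s j + inner ℝ (η j) (u - q j) ≤ s i + inner ℝ (η i) (u - q i) + φ i u)
    {h : Z → ℝ} (hh : ∀ u, IsGLB (range fun i : ι =>
      s i + inner ℝ (η i) (u - q i) + φ i u + a * theta ω ‖u - q i‖) (h u)) :
    LocSemiconcave ω h := by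
  intro R hR
  have hle : ∀ i u, h u ≤ s i + inner ℝ (η i) (u - q i) + φ i u + a * theta ω ‖u - q i‖ :=
    fun i u => (hh u).1 ⟨i, rfl⟩
  let j : ι := Classical.arbitrary ι
  have hθ : Continuous fun u : Z => theta ω ‖u - q j‖ :=
    hω.continuousOn_theta.comp_continuous (by fun_prop) fun u => norm_nonneg _
  have hφc : Continuous (φ j) := (hd j).continuous
  obtain ⟨B, hB⟩ := (isCompact_closedBall (0 : Z) R).bddAbove_image
    (f := fun u => φ j u + a * theta ω ‖u - q j‖) (by fun_prop)
  replace hB : ∀ u : Z, ‖u‖ ≤ R → φ j u + a * theta ω ‖u - q j‖ ≤ B := fun u hx =>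
    hB ⟨u, by simpa using hx, rfl⟩
  -- An index within `1` of the infimum at `x` has `a θ(‖x - q i‖) < B + 1`: by `ht` the rest of its
  -- term is at least the affine function of index `j`, while `h x` exceeds that function by at most
  -- `B`. Hence `‖x - q i‖ ≤ r`, and one constant `M` serves all relevant indices.
  obtain ⟨r, hr0, hr⟩ := hω.exists_lt_theta ((B + 1) / a)
  obtain ⟨M, hM⟩ := hu (max (2 * R) (R + r)) (lt_max_of_lt_left (by positivity))
  refine ⟨2 * |M| + 2 * a, by positivity, fun x z hx hz => le_of_forall_pos_le_add fun ε hε => ?_⟩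
  obtain ⟨_, ⟨i, rfl⟩, hi⟩ := (isGLB_lt_iff (hh x)).1
    (show h x < h x + min 1 (ε / 2) from lt_add_of_pos_right _ (by positivity))
  dsimp only at hi
  have hqi : ‖q i‖ ≤ R + r := by
    have h1 : ‖x - q i‖ ≤ r := by
      by_contra! hlt
      have h2 := hr _ hlt
      rw [div_lt_iff₀ ha] at h2
      have := hle j x
      have := ht i j x
      have := hB x hx
      have : min 1 (ε / 2) ≤ 1 := min_le_left _ _
      linarith
    calc ‖q i‖ = ‖x - (x - q i)‖ := by rw [sub_sub_cancel]
      _ ≤ ‖x‖ + ‖x - q i‖ := norm_sub_le _ _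
      _ ≤ _ := by linarith
  have h1 := add_sub_le_of_gradient hω (hd i) (abs_nonneg M) (fun u v hu hv huv =>
    (hM i u v (hqi.trans (le_max_right _ _)) (hu.trans (le_max_left _ _))
      (hv.trans (le_max_left _ _)) huv).trans (le_abs_self M)) hx hz
  have h2 := mul_le_mul_of_nonneg_left (hω.theta_norm_add_sub_le (x - q i) z) ha.le
  have h3 := hle i (x + z)
  have h4 := hle i (x - z)
  rw [show x + z - q i = x - q i + z by abel, inner_add_right] at h3
  rw [show x - z - q i = x - q i - z by abel, inner_sub_right] at h4
  have h5 : min 1 (ε / 2) ≤ ε / 2 := min_le_right _ _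
  linarith

/-- The convex envelope of the infimum of a family of functions `ℓ_i + φ_i + a θ(|· - q_i|)` is a
`C^{1,ω}_loc` convex extension of the jet. -/
theorem exists_convex_envelope {ω : ℝ → ℝ} (hω : IsModulus ω) {s : ι → ℝ} {η q : ι → Z}
    {φ : ι → Z → ℝ} {a : ℝ} (ha : 0 < a) (hη : diffSpan η = ⊤)
    (hd : ∀ i, Differentiable ℝ (φ i)) (hφ : ∀ i, φ i (q i) = 0)
    (hu : ∀ R : ℝ, 0 < R → ∃ M : ℝ, ∀ (i : ι) (u v : Z), ‖q i‖ ≤ R → ‖u‖ ≤ R → ‖v‖ ≤ R → u ≠ v →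
      ‖gradient (φ i) u - gradient (φ i) v‖ / ω ‖u - v‖ ≤ M)
    (ht : ∀ i j u, s j + inner ℝ (η j) (u - q j) ≤ s i + inner ℝ (η i) (u - q i) + φ i u) :
    ∃ h C : Z → ℝ, (∀ u, IsGLB (range fun i : ι =>
      s i + inner ℝ (η i) (u - q i) + φ i u + a * theta ω ‖u - q i‖) (h u)) ∧
      ConvexOn ℝ univ C ∧ (∀ u, C u ≤ h u) ∧
      (∀ ψ : Z → ℝ, ConvexOn ℝ univ ψ → (∀ u, ψ u ≤ h u) → ∀ u, ψ u ≤ C u) ∧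
      IsC1OmegaLoc ω C ∧ (∀ i, C (q i) = s i) ∧ (∀ i, gradient C (q i) = η i) ∧
      EssCoercive C := by
  have hlow : ∀ j u i, s j + inner ℝ (η j) (u - q j) ≤
      s i + inner ℝ (η i) (u - q i) + φ i u + a * theta ω ‖u - q i‖ := fun j u i =>
    (ht i j u).trans (le_add_of_nonneg_right (mul_nonneg ha.le (hω.theta_nonneg (norm_nonneg _))))
  let h : Z → ℝ := fun u => ⨅ i,
    (s i + inner ℝ (η i) (u - q i) + φ i u + a * theta ω ‖u - q i‖)
  have hh : ∀ u, IsGLB (range fun i : ι =>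
      s i + inner ℝ (η i) (u - q i) + φ i u + a * theta ω ‖u - q i‖) (h u) := fun u =>
    isGLB_ciInf ⟨_, by rintro _ ⟨i, rfl⟩; exact hlow (Classical.arbitrary ι) u i⟩
  have hlh : ∀ j u, s j + inner ℝ (η j) (u - q j) ≤ h u := fun j u =>
    (hh u).2 (by rintro _ ⟨i, rfl⟩; exact hlow j u i)
  obtain ⟨p, c, K, hc, hpc⟩ := exists_coercive_bound s η q hη
  have hb : ∀ u, inner ℝ p u + c * ‖u‖ - K ≤ h u := fun u => hpc u _ fun j => hlh j u
  have hψ := convexOn_inner_add_mul_norm_sub p hc.le K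
  have hC := convexOn_convEnv hψ hb
  have hreg := isC1OmegaLoc_of_locSemiconcave hω hC
    ((locSemiconcave_of_isGLB hω ha hd hu ht hh).convEnv hω hc hb)
  have hlC : ∀ j u, s j + inner ℝ (η j) (u - q j) ≤ convEnv h u := fun j u =>
    le_convEnv (convexOn_affine (s j) (η j) (q j)) (hlh j) u
  have hval : ∀ i, convEnv h (q i) = s i := by
    intro i
    refine le_antisymm ((convEnv_le hψ hb _).trans (((hh (q i)).1 ⟨i, rfl⟩).trans ?_)) ?_
    · simp [hφ, theta_zero]
    · simpa using hlC i (q i)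
  refine ⟨h, convEnv h, hh, hC, convEnv_le hψ hb, fun ψ h1 h2 u => le_convEnv h1 h2 u, hreg, hval,
    fun i => ?_, innerₛₗ ℝ p, ?_⟩
  -- Along every line through `q i`, the envelope minus the affine function of the jet has a minimum
  -- at `q i`, so its derivative there vanishes.
  · refine ext_inner_right ℝ fun z => ?_
    have h1 : HasDerivAt (fun t : ℝ => convEnv h (q i + t • z))
        (inner ℝ (gradient (convEnv h) (q i)) z) 0 :=
      hasDerivAt_comp_line (by simpa using (hreg.1 (q i)).hasGradientAt)
    have h2 := h1.sub ((hasDerivAt_id (0 : ℝ)).mul_const (inner ℝ (η i) z))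
    have hmin : IsLocalMin ((fun t : ℝ => convEnv h (q i + t • z)) -
        fun t : ℝ => id t * inner ℝ (η i) z) 0 := by
      refine Filter.Eventually.of_forall fun t => ?_
      have := hlC i (q i + t • z)
      rw [add_sub_cancel_left, inner_smul_right] at this
      simp [hval]
      linarith
    have := hmin.hasDerivAt_eq_zero h2
    linarith
  · have h1 : Tendsto (fun u : Z => c * ‖u‖ + -K) (Bornology.cobounded Z) atTop :=
      tendsto_atTop_add_const_right _ _ (tendsto_norm_cobounded_atTop.const_mul_atTop hc)
    refine tendsto_atTop_mono (fun u => ?_) h1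
    have := hpc u _ fun j => hlC j u
    simp
    linarith

end Jet

/-! ### Transfer of gradients and regularity between the whole space and `X`. -/

section Projection

variable {Z : Type*} [NormedAddCommGroup Z] [InnerProductSpace ℝ Z] [FiniteDimensional ℝ Z]
  {X : Submodule ℝ Z}

/-- Chain rule: the adjoint of the projection onto `X` is the inclusion of `X`. -/
theorem hasGradientAt_comp_projection_add_inner {c : X → ℝ} {p : X} {x : Z}
    (h : HasGradientAt c p (X.orthogonalProjectionOnto x)) (v : Z) :
    HasGradientAt (fun x => c (X.orthogonalProjectionOnto x) + inner ℝ v x) ((p : Z) + v) x := by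
  have h1 := (h.hasFDerivAt.comp x X.orthogonalProjectionOnto.hasFDerivAt).add
    (innerSL ℝ v).hasFDerivAt
  rw [hasGradientAt_iff_hasFDerivAt]
  refine h1.congr_fderiv ?_
  ext y
  simp only [ContinuousLinearMap.comp_apply, add_apply, InnerProductSpace.toDual_apply_apply,
    innerSL_apply_apply, inner_add_left]
  rw [X.inner_orthogonalProjectionOnto_eq_of_mem_left p y]

theorem hasGradientAt_restrict {F : Z → ℝ} {p : Z} {u : X} (h : HasGradientAt F p (u : Z)) :
    HasGradientAt (fun u : X => F u) (X.orthogonalProjectionOnto p) u := by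
  have h1 := h.hasFDerivAt.comp u X.subtypeL.hasFDerivAt
  rw [hasGradientAt_iff_hasFDerivAt]
  refine h1.congr_fderiv ?_
  ext y
  exact (X.inner_orthogonalProjectionOnto_eq_of_mem_right y p).symm

theorem IsC1OmegaLoc.comp_projection_add_inner {ω : ℝ → ℝ} (hω : IsModulus ω) {c : X → ℝ}
    (hc : IsC1OmegaLoc ω c) (v : Z) :
    IsC1OmegaLoc ω fun x => c (X.orthogonalProjectionOnto x) + inner ℝ v x := by
  have hg : ∀ x, HasGradientAt (fun x => c (X.orthogonalProjectionOnto x) + inner ℝ v x)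
      ((gradient c (X.orthogonalProjectionOnto x) : X) + v) x := fun x =>
    hasGradientAt_comp_projection_add_inner (hc.1 _).hasGradientAt v
  refine ⟨fun x => (hg x).differentiableAt, fun R hR => ?_⟩
  obtain ⟨M, hM⟩ := hc.2 R hR
  refine ⟨|M|, fun x y hx hy hxy => ?_⟩
  rw [(hg x).gradient, (hg y).gradient, add_sub_add_right_eq_sub, ← Submodule.coe_sub,
    ← Submodule.coe_norm, div_le_iff₀ (hω.pos (norm_pos_iff.2 (sub_ne_zero.2 hxy)))]
  by_cases hP : X.orthogonalProjectionOnto x = X.orthogonalProjectionOnto y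
  · rw [hP, sub_self, norm_zero]
    exact mul_nonneg (abs_nonneg M) (hω.nonneg (norm_nonneg _))
  have h1 := hM _ _ ((X.norm_orthogonalProjectionOnto_apply_le x).trans hx)
    ((X.norm_orthogonalProjectionOnto_apply_le y).trans hy) hP
  rw [div_le_iff₀ (hω.pos (norm_pos_iff.2 (sub_ne_zero.2 hP)))] at h1
  refine h1.trans (mul_le_mul (le_abs_self M) (hω.mono (norm_nonneg _) ?_)
    (hω.nonneg (norm_nonneg _)) (abs_nonneg M))
  rw [← map_sub]
  exact X.norm_orthogonalProjectionOnto_apply_le _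

theorem IsC1OmegaLoc.restrict {ω : ℝ → ℝ} (hω : IsModulus ω) {F : Z → ℝ} (hF : IsC1OmegaLoc ω F) :
    IsC1OmegaLoc ω fun u : X => F u := by
  have hg : ∀ u : X, HasGradientAt (fun u : X => F u)
      (X.orthogonalProjectionOnto (gradient F u)) u := fun u =>
    hasGradientAt_restrict (hF.1 _).hasGradientAt
  refine ⟨fun u => (hg u).differentiableAt, fun R hR => ?_⟩
  obtain ⟨M, hM⟩ := hF.2 R hR
  refine ⟨M, fun u v hu hv huv => le_trans ?_ (hM u v hu hv (fun h => huv (Subtype.ext h)))⟩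
  rw [(hg u).gradient, (hg v).gradient, ← map_sub]
  exact div_le_div_of_nonneg_right (X.norm_orthogonalProjectionOnto_apply_le _)
    (hω.nonneg (norm_nonneg _))

end Projection

/-! ### Sufficiency: reduction to `X`. -/

variable {n : ℕ}

/-- The formula provides a `C^{1,ω}_loc` convex extension of every admissible jet. -/
theorem IsAdmissible.exists_isFormula {ω : ℝ → ℝ} (hω : IsModulus ω)
    {X : Submodule ℝ (EuclideanSpace ℝ (Fin n))} {ι : Type*} [Nonempty ι]
    {pt : ι → EuclideanSpace ℝ (Fin n)} {t : ι → ℝ} {ξ : ι → EuclideanSpace ℝ (Fin n)}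
    {φ : ι → X → ℝ} (hA : IsAdmissible ω X pt t ξ φ) {a : ℝ} (ha : 0 < a) :
    ∃ F : EuclideanSpace ℝ (Fin n) → ℝ, IsFormula ω X pt t ξ φ a F ∧ ConvexOn ℝ univ F ∧
      IsC1OmegaLoc ω F ∧ (∀ i, F (pt i) = t i) ∧ (∀ i, gradient F (pt i) = ξ i) ∧
      HasCoerciveSubspace F X := by
  let P := X.orthogonalProjectionOnto
  let i₀ : ι := Classical.arbitrary ι
  -- The choice of `i₀` is immaterial, since all slopes have the same component orthogonal to `X`.
  let v := ξ i₀ - P (ξ i₀)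
  have hv : v ∈ Xᗮ := X.sub_starProjection_mem_orthogonal (ξ i₀)
  let η : ι → X := fun i => P (ξ i)
  have hξ : ∀ i, ξ i = (η i : EuclideanSpace ℝ (Fin n)) + v := by
    intro i
    have h1 : ξ i - ξ i₀ ∈ X := hA.span_eq ▸ sub_mem_diffSpan ξ i i₀
    have h2 : ((P (ξ i - ξ i₀) : X) : EuclideanSpace ℝ (Fin n)) = ξ i - ξ i₀ :=
      X.starProjection_eq_self_iff.2 h1
    rw [map_sub, Submodule.coe_sub] at h2
    simp only [η, v]
    rw [← sub_eq_zero] at h2 ⊢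
    rw [← neg_eq_zero, ← h2]
    abel
  have hη : diffSpan η = ⊤ := by
    refine Submodule.map_injective_of_injective X.injective_subtype ?_
    rw [Submodule.map_subtype_top, diffSpan, Submodule.map_span]
    refine Eq.trans (congrArg (Submodule.span ℝ) ?_) hA.span_eq
    have e : ∀ i j, ξ i - ξ j = ((η i - η j : X) : EuclideanSpace ℝ (Fin n)) := fun i j => by
      rw [hξ i, hξ j, Submodule.coe_sub]; abel
    ext d
    constructor
    · rintro ⟨_, ⟨i, j, rfl⟩, rfl⟩
      exact ⟨i, j, (e i j).symm⟩
    · rintro ⟨i, j, rfl⟩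
      exact ⟨_, ⟨i, j, rfl⟩, (e i j).symm⟩
  let q : ι → X := fun i => P (pt i)
  let s : ι → ℝ := fun i => t i - inner ℝ v (pt i)
  have hℓ : ∀ i x, t i + inner ℝ (ξ i) (x - pt i) =
      inner ℝ v x + (s i + inner ℝ (η i) (P x - q i)) := by
    intro i x
    have h1 : inner ℝ (η i) (P x - q i) =
        inner ℝ (η i : EuclideanSpace ℝ (Fin n)) (x - pt i) := by
      rw [← map_sub]; exact Submodule.inner_orthogonalProjectionOnto_eq_of_mem_left _ _
    rw [h1, hξ i, inner_add_left, inner_sub_right v]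
    simp only [s]
    ring
  have hPX : ∀ u : X, P u = u := X.orthogonalProjectionOnto_mem_subspace_eq_self
  obtain ⟨h, C, hh, hC, hCh, hmax, hreg, hval, hgrad, hco⟩ := exists_convex_envelope hω ha
    (s := s) (η := η) (q := q) (φ := φ) hη (fun i => (hA.isC1OmegaLoc i).1)
    hA.map_eq_zero hA.uniform (fun i j u => by
      have := hA.tangent_le i j u
      rw [hℓ, hℓ] at this
      simp only [P, X.orthogonalProjectionOnto_mem_subspace_eq_self] at this
      linarith)
  let F : EuclideanSpace ℝ (Fin n) → ℝ := fun x => C (P x) + inner ℝ v x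
  have hFC : ConvexOn ℝ univ F :=
    (hC.comp_linearMap P.toLinearMap).add ((innerₛₗ ℝ v).convexOn convex_univ)
  refine ⟨F, ⟨fun x => inner ℝ v x + h (P x), fun x => ?_, fun x => ⟨?_, ?_⟩⟩, hFC,
    hreg.comp_projection_add_inner hω v, fun i => ?_, fun i => ?_, C, v, hco, hv, fun x => rfl⟩
  · have e : ∀ i, t i + inner ℝ (ξ i) (x - pt i) + φ i (P x) + a * theta ω ‖P (x - pt i)‖ =
        inner ℝ v x + (s i + inner ℝ (η i) (P x - q i) + φ i (P x) +
          a * theta ω ‖P x - q i‖) := fun i => by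
      rw [hℓ, map_sub]; simp only [q]; ring
    constructor
    · rintro _ ⟨i, rfl⟩
      have h1 := (hh (P x)).1 ⟨i, rfl⟩
      have h2 := e i
      dsimp only at h1 ⊢
      linarith
    · intro b hb
      have h1 : b - inner ℝ v x ≤ h (P x) := (hh (P x)).2 (by
        rintro _ ⟨i, rfl⟩
        have h1 := hb ⟨i, rfl⟩
        have h2 := e i
        dsimp only at h1 ⊢
        linarith)
      linarith
  · rintro _ ⟨ψ, hψ, hle, rfl⟩
    -- A competitor `ψ` is restricted to the slice `w + X` through `x`, on which `⟨v, ·⟩` is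
    -- constant; there it competes for the envelope on `X`.
    let w : EuclideanSpace ℝ (Fin n) := x - P x
    have hPw : P w = 0 := by simp only [w, map_sub, hPX, sub_self]
    have hψ' : ConvexOn ℝ univ fun u : X => ψ (u + w) - inner ℝ v x := by
      have h1 : ConvexOn ℝ univ fun u : X => ψ (w + u) := by
        have := (hψ.translate_right w).comp_linearMap X.subtype
        simpa [Function.comp_def] using this
      exact (h1.add_const (-inner ℝ v x)).congr fun u _ => by simp [sub_eq_add_neg, add_comm]
    have h1 := hmax _ hψ' (fun u => by
      have h2 : ψ (u + w) ≤ inner ℝ v (u + w) + h (P (u + w)) := hle (u + w)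
      have h3 : inner ℝ v ((u : EuclideanSpace ℝ (Fin n)) + w) = inner ℝ v x := by
        have h4 := Submodule.inner_left_of_mem_orthogonal u.2 hv
        have h5 := Submodule.inner_left_of_mem_orthogonal (P x).2 hv
        simp only [w, inner_add_right, inner_sub_right, h4, h5]
        ring
      rw [h3, map_add, hPX, hPw, add_zero] at h2
      linarith) (P x)
    simp only [w, add_sub_cancel] at h1
    simp only [F]
    linarith
  · intro b hb
    refine hb ⟨F, hFC, fun z => ?_, rfl⟩
    have := hCh (P z)
    simp only [F]
    linarith
  · have := hval i
    simp only [F]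
    simp only [q, s] at this
    rw [this]; ring
  · have h1 : HasGradientAt F ((gradient C (q i) : X) + v) (pt i) :=
      hasGradientAt_comp_projection_add_inner (hreg.1 _).hasGradientAt v
    rw [h1.gradient, hgrad, ← hξ]

/-! ### Spans of differences and the choice of additional points. -/

section Span

variable {Z : Type*} [NormedAddCommGroup Z] [InnerProductSpace ℝ Z]

theorem diffSpan_le_iff {ι : Type*} {ξ : ι → Z} {X : Submodule ℝ Z} :
    diffSpan ξ ≤ X ↔ ∀ i j, ξ i - ξ j ∈ X := by
  rw [diffSpan, Submodule.span_le]
  constructor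
  · exact fun h i j => h ⟨i, j, rfl⟩
  · rintro h _ ⟨i, j, rfl⟩
    exact h i j

theorem diffSpan_mono {ι κ : Type*} {ξ : ι → Z} {ζ : κ → Z} (h : range ξ ⊆ range ζ) :
    diffSpan ξ ≤ diffSpan ζ := by
  refine diffSpan_le_iff.2 fun i j => ?_
  obtain ⟨i', hi⟩ := h ⟨i, rfl⟩
  obtain ⟨j', hj⟩ := h ⟨j, rfl⟩
  rw [← hi, ← hj]
  exact sub_mem_diffSpan ζ i' j'

theorem diffSpan_congr {ι κ : Type*} {ξ : ι → Z} {ζ : κ → Z} (h : range ξ = range ζ) :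
    diffSpan ξ = diffSpan ζ :=
  le_antisymm (diffSpan_mono h.subset) (diffSpan_mono h.superset)

/-- The span of the differences of the values of `A` on a nonempty set `S` can be enlarged to the
span of all differences by adding as many points as there are missing dimensions. -/
theorem exists_points_diffSpan_eq [FiniteDimensional ℝ Z] {α : Type*} (A : α → Z) (m : ℕ) :
    ∀ S : Set α, S.Nonempty →
      Module.finrank ℝ (diffSpan fun y : S => A y) + m = Module.finrank ℝ (diffSpan A) →
      ∃ p : Fin m → α, Function.Injective p ∧ (∀ j, p j ∉ S) ∧
        diffSpan (Sum.elim (fun y : S => A y) (A ∘ p)) = diffSpan A := by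
  have hle : ∀ S : Set α, diffSpan (fun y : S => A y) ≤ diffSpan A := fun S =>
    diffSpan_mono (by rintro _ ⟨y, rfl⟩; exact ⟨y, rfl⟩)
  induction m with
  | zero =>
    intro S _ hS
    refine ⟨Fin.elim0, fun i => i.elim0, fun i => i.elim0, ?_⟩
    rw [← Submodule.eq_of_le_of_finrank_eq (hle S) hS]
    exact diffSpan_congr (by simp [Sum.elim_range])
  | succ m ih =>
    intro S hSne hS
    obtain ⟨y, hy⟩ := hSne
    -- A point whose value leaves the current span raises the dimension by exactly one, and it
    -- cannot belong to `S`; this also makes the chosen points distinct.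
    obtain ⟨x, hx⟩ : ∃ x, A x - A y ∉ diffSpan fun y : S => A y := by
      by_contra! hall
      have h1 : diffSpan A ≤ diffSpan fun y : S => A y := diffSpan_le_iff.2 fun i j => by
        rw [← sub_sub_sub_cancel_right _ _ (A y)]
        exact Submodule.sub_mem _ (hall i) (hall j)
      have := Submodule.finrank_mono h1
      omega
    have hxS : x ∉ S := fun h => hx (sub_mem_diffSpan (fun y : S => A y) ⟨x, h⟩ ⟨y, hy⟩)
    have hins : diffSpan (fun z : (insert x S : Set α) => A z) =
        (diffSpan fun y : S => A y) ⊔ Submodule.span ℝ {A x - A y} := by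
      refine le_antisymm (diffSpan_le_iff.2 ?_) (sup_le (diffSpan_mono ?_) ?_)
      · have h1 : ∀ z : (insert x S : Set α), A z - A y ∈
            (diffSpan fun y : S => A y) ⊔ Submodule.span ℝ {A x - A y} := by
          rintro ⟨z, rfl | hz⟩
          · exact Submodule.mem_sup_right (Submodule.mem_span_singleton_self _)
          · exact Submodule.mem_sup_left
              (sub_mem_diffSpan (fun y : S => A y) ⟨z, hz⟩ ⟨y, hy⟩)
        intro i j
        rw [← sub_sub_sub_cancel_right (A i) (A j) (A y)]
        exact Submodule.sub_mem _ (h1 i) (h1 j)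
      · rintro _ ⟨z, rfl⟩
        exact ⟨⟨z, mem_insert_of_mem x z.2⟩, rfl⟩
      · rw [Submodule.span_singleton_le_iff_mem]
        exact sub_mem_diffSpan (fun z : (insert x S : Set α) => A z) ⟨x, mem_insert x S⟩
          ⟨y, mem_insert_of_mem x hy⟩
    obtain ⟨p, hp, hpS, hspan⟩ := ih (insert x S) ⟨x, mem_insert x S⟩ (by
      rw [hins, Submodule.finrank_sup_span_singleton hx]; omega)
    refine ⟨Fin.cons x p, Fin.cons_injective_iff.2 ⟨?_, hp⟩, ?_, ?_⟩
    · rintro ⟨j, hj⟩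
      exact hpS j (hj ▸ mem_insert x S)
    · refine Fin.cases hxS fun j => ?_
      rw [Fin.cons_succ]
      exact fun h => hpS j (mem_insert_of_mem x h)
    · rw [← hspan]
      refine diffSpan_congr ?_
      have h1 : ∀ T : Set α, range (fun y : T => A y) = A '' T := fun T => by
        rw [image_eq_range]
      rw [Sum.elim_range, Sum.elim_range, h1, h1, range_comp, range_comp, Fin.range_cons,
        image_insert_eq, image_insert_eq, union_insert, insert_union]

end Span

/-! ### Necessity: the jet induced by a convex function. -/

section Necessity

variable {Z : Type*} [NormedAddCommGroup Z] [InnerProductSpace ℝ Z] [FiniteDimensional ℝ Z]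

/-- The gradients of a differentiable function `F` affinely span `X_F`. -/
theorem HasCoerciveSubspace.diffSpan_gradient {F : Z → ℝ} {X : Submodule ℝ Z}
    (hF : Differentiable ℝ F) (h : HasCoerciveSubspace F X) : diffSpan (gradient F) = X := by
  obtain ⟨c, v, ⟨l, hl⟩, hv, hFc⟩ := h
  have hX : ∀ u : X, c u = F u := fun u => by
    rw [hFc, X.orthogonalProjectionOnto_mem_subspace_eq_self,
      Submodule.inner_left_of_mem_orthogonal u.2 hv, add_zero]
  have hc : ∀ u : X, HasGradientAt c (X.orthogonalProjectionOnto (gradient F u)) u := fun u => by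
    rw [funext hX]
    exact hasGradientAt_restrict (hF u).hasGradientAt
  have hg : ∀ x, gradient F x = (X.orthogonalProjectionOnto
      (gradient F (X.orthogonalProjectionOnto x)) : Z) + v := fun x => by
    have := hasGradientAt_comp_projection_add_inner (hc (X.orthogonalProjectionOnto x)) v
    rw [← funext hFc] at this
    exact this.gradient
  have hle : diffSpan (gradient F) ≤ X := diffSpan_le_iff.2 fun x y => by
    rw [hg x, hg y, add_sub_add_right_eq_sub]
    exact X.sub_mem (Subtype.property _) (Subtype.property _)
  by_contra hne
  -- If the span were smaller, some nonzero `w ∈ X` would be orthogonal to all gradient differences,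
  -- so the derivative of `F` along `w` would be constant.
  have hbot : (diffSpan (gradient F))ᗮ ⊓ X ≠ ⊥ := fun hbot => hne (by
    have := Submodule.sup_orthogonal_inf_of_hasOrthogonalProjection hle
    rwa [hbot, sup_bot_eq] at this)
  obtain ⟨w, hw, hw0⟩ := Submodule.exists_mem_ne_zero_of_ne_bot hbot
  -- `F` is affine in the direction `w`
  have hline : ∀ s : ℝ, F (s • w) = F 0 + s * inner ℝ (gradient F 0) w := by
    have hd : ∀ s : ℝ, HasDerivAt (fun s : ℝ => F (0 + s • w) - s * inner ℝ (gradient F 0) w)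
        (inner ℝ (gradient F (0 + s • w)) w - 1 * inner ℝ (gradient F 0) w) s := fun s =>
      (hasDerivAt_comp_line (hF _).hasGradientAt).sub ((hasDerivAt_id s).mul_const _)
    have h0 : ∀ s : ℝ,
        inner ℝ (gradient F (0 + s • w)) w - 1 * inner ℝ (gradient F 0) w = 0 := fun s => by
      rw [one_mul, ← inner_sub_left]
      exact Submodule.inner_right_of_mem_orthogonal (sub_mem_diffSpan (gradient F) _ _) hw.1
    intro s
    have := is_const_of_deriv_eq_zero (fun s => (hd s).differentiableAt)
      (fun s => by rw [(hd s).deriv, h0]) s 0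
    simp only [zero_add, zero_smul, zero_mul, sub_zero] at this
    linarith
  have hev := hl.eventually (eventually_gt_atTop (F 0))
  rw [← comap_norm_atTop, eventually_comap] at hev
  obtain ⟨R, hR⟩ := (hev.and (eventually_ge_atTop 0)).exists
  have hwn : ‖w‖ ≠ 0 := norm_ne_zero_iff.2 hw0
  let u : X := (R / ‖w‖) • ⟨w, hw.2⟩
  have hu : ‖u‖ = R := by
    rw [norm_smul, Real.norm_of_nonneg (div_nonneg hR.2 (norm_nonneg _)), Submodule.coe_norm,
      div_mul_cancel₀ _ hwn]
  -- On this line `c - l` is affine with value `F 0` at the origin, so it cannot exceed `F 0` at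
  -- both `u` and `-u`.
  have h3 := hR.1 u hu
  have h4 := hR.1 (-u) (by rw [norm_neg, hu])
  have h5 : c u = F 0 + R / ‖w‖ * inner ℝ (gradient F 0) w := by
    rw [hX, ← hline]; rfl
  have h6 : c (-u) = F 0 + -(R / ‖w‖) * inner ℝ (gradient F 0) w := by
    rw [hX, ← hline, neg_smul]; rfl
  rw [map_neg] at h4
  linarith

/-- A `C^{1,ω}_loc` convex function induces an admissible jet on every set on which its gradients
affinely span `X_F`. -/
theorem exists_isAdmissible {n : ℕ} {ω : ℝ → ℝ} (hω : IsModulus ω)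
    {X : Submodule ℝ (EuclideanSpace ℝ (Fin n))} {F : EuclideanSpace ℝ (Fin n) → ℝ}
    (hconv : ConvexOn ℝ univ F) (hF : IsC1OmegaLoc ω F) (h : HasCoerciveSubspace F X) {ι : Type*}
    {pt : ι → EuclideanSpace ℝ (Fin n)} (hspan : diffSpan (fun i => gradient F (pt i)) = X) :
    ∃ φ : ι → X → ℝ,
      IsAdmissible ω X pt (fun i => F (pt i)) (fun i => gradient F (pt i)) φ := by
  obtain ⟨c, v, -, hv, hFc⟩ := h
  have hX : c = fun u : X => F u := funext fun u => by
    rw [hFc, X.orthogonalProjectionOnto_mem_subspace_eq_self,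
      Submodule.inner_left_of_mem_orthogonal u.2 hv, add_zero]
  have hc : IsC1OmegaLoc ω c := hX ▸ hF.restrict hω
  have hcc : ConvexOn ℝ univ c := hX ▸ hconv.comp_linearMap X.subtype
  let P := X.orthogonalProjectionOnto
  have hg : ∀ x, gradient F x = (gradient c (P x) : X) + v := fun x => by
    have := hasGradientAt_comp_projection_add_inner (hc.1 (P x)).hasGradientAt v
    rw [← funext hFc] at this
    exact this.gradient
  -- The first-order Taylor remainder of `c` at `P (pt i)`. It is nonnegative by convexity, and its
  -- gradient differs from that of `c` by a constant, so a single modulus bound holds for all `i`.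
  let φ : ι → X → ℝ := fun i u =>
    c u - c (P (pt i)) - inner ℝ (gradient c (P (pt i))) (u - P (pt i))
  have hφ : ∀ i u, HasGradientAt (φ i) (gradient c u - gradient c (P (pt i))) u := by
    intro i u
    have h1 := ((hc.1 u).hasGradientAt.hasFDerivAt.sub_const (c (P (pt i)))).sub
      ((innerSL ℝ (gradient c (P (pt i)))).hasFDerivAt.comp u
        ((hasFDerivAt_id u).sub_const (P (pt i))))
    rw [hasGradientAt_iff_hasFDerivAt]
    refine h1.congr_fderiv ?_
    ext y
    simp [inner_sub_left]
  have hφu : ∀ R : ℝ, 0 < R → ∃ M : ℝ, ∀ (i : ι) (u v : X), ‖u‖ ≤ R → ‖v‖ ≤ R → u ≠ v →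
      ‖gradient (φ i) u - gradient (φ i) v‖ / ω ‖u - v‖ ≤ M := by
    intro R hR
    obtain ⟨M, hM⟩ := hc.2 R hR
    refine ⟨M, fun i u v hu hv huv => ?_⟩
    rw [(hφ i u).gradient, (hφ i v).gradient, sub_sub_sub_cancel_right]
    exact hM u v hu hv huv
  refine ⟨φ, fun i u => ?_, fun i => ⟨fun u => (hφ i u).differentiableAt, fun R hR => ?_⟩, hspan,
    fun i => ?_, fun i => ?_, fun R hR => ?_, fun i j x => ?_⟩
  · have := inner_gradient_le hcc (hc.1 (P (pt i))).hasGradientAt u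
    simp only [φ]
    linarith
  · obtain ⟨M, hM⟩ := hφu R hR
    exact ⟨M, hM i⟩
  · simp [φ, P]
  · rw [(hφ i _).gradient, sub_self]
  · obtain ⟨M, hM⟩ := hφu R hR
    exact ⟨M, fun i u v _ => hM i u v⟩
  -- With this `φ` the right-hand side equals `F x`, so the inequality says that `F` lies above its
  -- tangent at `pt j`.
  · have h1 := inner_gradient_le hconv (hF.1 (pt j)).hasGradientAt x
    refine h1.trans (le_of_eq ?_)
    have h2 : inner ℝ (gradient c (P (pt i))) (P x - P (pt i)) =
        inner ℝ ((gradient c (P (pt i)) : X) : EuclideanSpace ℝ (Fin n)) (x - pt i) := by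
      rw [← map_sub]; exact Submodule.inner_orthogonalProjectionOnto_eq_of_mem_left _ _
    simp only [φ]
    rw [hg, inner_add_left, hFc, hFc, ← h2, inner_sub_right v]
    ring

end Necessity

/-! ### Assembly of the theorem. -/

/-- The formula solves the extension problem for a jet extended by additional data. -/
theorem IsAdmissible.exists_isConvexExtension_sum {n : ℕ} {ω : ℝ → ℝ}
    (hω : IsModulus ω) {E : Set (EuclideanSpace ℝ (Fin n))} (hE : E.Nonempty)
    {X : Submodule ℝ (EuclideanSpace ℝ (Fin n))} {f : E → ℝ} {G : E → EuclideanSpace ℝ (Fin n)}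
    {κ : Type*} {p : κ → EuclideanSpace ℝ (Fin n)} {β : κ → ℝ} {w : κ → EuclideanSpace ℝ (Fin n)}
    {φ : E ⊕ κ → X → ℝ} (hφ : IsAdmissible ω X (Sum.elim Subtype.val p) (Sum.elim f β)
      (Sum.elim G w) φ) {a : ℝ} (ha : 0 < a) :
    ∃ F : EuclideanSpace ℝ (Fin n) → ℝ,
      IsFormula ω X (Sum.elim Subtype.val p) (Sum.elim f β) (Sum.elim G w) φ a F ∧
      IsConvexExtension ω X E f G F := by
  have : Nonempty (E ⊕ κ) := ⟨Sum.inl ⟨_, hE.some_mem⟩⟩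
  obtain ⟨F, hF, h1, h2, h3, h4, h5⟩ := hφ.exists_isFormula hω ha
  exact ⟨F, hF, h1, h2, fun y => h3 (Sum.inl y), fun y => h4 (Sum.inl y), h5⟩

/-- The formula solves the extension problem for an admissible jet. -/
theorem IsAdmissible.exists_isConvexExtension {n : ℕ} {ω : ℝ → ℝ}
    (hω : IsModulus ω) {E : Set (EuclideanSpace ℝ (Fin n))} (hE : E.Nonempty)
    {X : Submodule ℝ (EuclideanSpace ℝ (Fin n))} {f : E → ℝ} {G : E → EuclideanSpace ℝ (Fin n)}
    {φ : E → X → ℝ} (hφ : IsAdmissible ω X Subtype.val f G φ) {a : ℝ} (ha : 0 < a) :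
    ∃ F : EuclideanSpace ℝ (Fin n) → ℝ, IsFormula ω X Subtype.val f G φ a F ∧
      IsConvexExtension ω X E f G F := by
  have : Nonempty E := hE.to_subtype
  obtain ⟨F, hF, h1, h2, h3, h4, h5⟩ := hφ.exists_isFormula hω ha
  exact ⟨F, hF, h1, h2, h3, h4, h5⟩

end ConvexJet

theorem mainTheorem5 (n : ℕ) (ω : ℝ → ℝ) (hω : ConvexJet.IsModulus ω)
    (E : Set (EuclideanSpace ℝ (Fin n))) (hE : E.Nonempty)
    (X : Submodule ℝ (EuclideanSpace ℝ (Fin n)))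
    (f : E → ℝ) (G : E → EuclideanSpace ℝ (Fin n)) :
    -- the characterization
    ((∃ F : EuclideanSpace ℝ (Fin n) → ℝ, ConvexJet.IsConvexExtension ω X E f G F) ↔
      -- (i)
      (ConvexJet.diffSpan G ≤ X ∧
      -- (ii) : the set `E ∪ {p₁, …, p_{d-k}}` is indexed by `E ⊕ Fin (d - k)`
      (Module.finrank ℝ (ConvexJet.diffSpan G) < Module.finrank ℝ X →
        ∃ (p : Fin (Module.finrank ℝ X - Module.finrank ℝ (ConvexJet.diffSpan G)) →
              EuclideanSpace ℝ (Fin n))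
          (β : Fin (Module.finrank ℝ X - Module.finrank ℝ (ConvexJet.diffSpan G)) → ℝ)
          (w : Fin (Module.finrank ℝ X - Module.finrank ℝ (ConvexJet.diffSpan G)) →
              EuclideanSpace ℝ (Fin n))
          (φ : E ⊕ Fin (Module.finrank ℝ X - Module.finrank ℝ (ConvexJet.diffSpan G)) → X → ℝ),
          Function.Injective p ∧ (∀ j, p j ∉ E) ∧
          ConvexJet.IsAdmissible ω X (Sum.elim Subtype.val p) (Sum.elim f β) (Sum.elim G w) φ) ∧
      -- (iii)
      (Module.finrank ℝ (ConvexJet.diffSpan G) = Module.finrank ℝ X →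
        ∃ φ : E → X → ℝ, ConvexJet.IsAdmissible ω X Subtype.val f G φ))) ∧
    -- the formula, when new data are added
    (ConvexJet.diffSpan G ≤ X →
      Module.finrank ℝ (ConvexJet.diffSpan G) < Module.finrank ℝ X →
      ∀ (p : Fin (Module.finrank ℝ X - Module.finrank ℝ (ConvexJet.diffSpan G)) →
            EuclideanSpace ℝ (Fin n))
        (β : Fin (Module.finrank ℝ X - Module.finrank ℝ (ConvexJet.diffSpan G)) → ℝ)
        (w : Fin (Module.finrank ℝ X - Module.finrank ℝ (ConvexJet.diffSpan G)) →
            EuclideanSpace ℝ (Fin n))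
        (φ : E ⊕ Fin (Module.finrank ℝ X - Module.finrank ℝ (ConvexJet.diffSpan G)) → X → ℝ),
        Function.Injective p → (∀ j, p j ∉ E) →
        ConvexJet.IsAdmissible ω X (Sum.elim Subtype.val p) (Sum.elim f β) (Sum.elim G w) φ →
        ∀ a : ℝ, 0 < a → ∃ F : EuclideanSpace ℝ (Fin n) → ℝ,
          ConvexJet.IsFormula ω X (Sum.elim Subtype.val p) (Sum.elim f β) (Sum.elim G w) φ a F ∧
          ConvexJet.IsConvexExtension ω X E f G F) ∧
    -- the formula, when no new data are needed
    (ConvexJet.diffSpan G ≤ X →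
      Module.finrank ℝ (ConvexJet.diffSpan G) = Module.finrank ℝ X →
      ∀ φ : E → X → ℝ, ConvexJet.IsAdmissible ω X Subtype.val f G φ →
        ∀ a : ℝ, 0 < a → ∃ F : EuclideanSpace ℝ (Fin n) → ℝ,
          ConvexJet.IsFormula ω X Subtype.val f G φ a F ∧
          ConvexJet.IsConvexExtension ω X E f G F) := by
  refine ⟨⟨?_, ?_⟩, ?_, ?_⟩
  · rintro ⟨F, hF⟩
    have hspan := hF.coerciveSubspace.diffSpan_gradient hF.isC1OmegaLoc.1
    have hG : (fun y : E => gradient F y) = G := funext hF.gradient_eq_on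
    have hf : (fun y : E => F y) = f := funext hF.eq_on
    have hle : ConvexJet.diffSpan G ≤ X := by
      rw [← hspan]
      exact ConvexJet.diffSpan_mono (by rintro _ ⟨y, rfl⟩; exact ⟨y, hF.gradient_eq_on y⟩)
    refine ⟨hle, fun hlt => ?_, fun heq => ?_⟩
    -- The missing data are read off `F` itself: values and gradients at points that complete the
    -- span.
    · obtain ⟨p, hp, hpE, hpX⟩ := ConvexJet.exists_points_diffSpan_eq (gradient F)
        (Module.finrank ℝ X - Module.finrank ℝ (ConvexJet.diffSpan G)) E hE (by
          rw [hspan, hG]; omega)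
      have eG : (fun i => gradient F ((Sum.elim Subtype.val p : E ⊕ _ → _) i)) =
          Sum.elim G (gradient F ∘ p) := by
        funext i
        rcases i with y | j
        · exact hF.gradient_eq_on y
        · rfl
      have ef : (fun i => F ((Sum.elim Subtype.val p : E ⊕ _ → _) i)) =
          Sum.elim f (F ∘ p) := by
        funext i
        rcases i with y | j
        · exact hF.eq_on y
        · rfl
      obtain ⟨φ, hφ⟩ := ConvexJet.exists_isAdmissible hω hF.convexOn hF.isC1OmegaLoc
        hF.coerciveSubspace (pt := (Sum.elim Subtype.val p : E ⊕ _ → _))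
        (by rw [eG]; rw [hG] at hpX; exact hpX.trans hspan)
      rw [eG, ef] at hφ
      exact ⟨p, F ∘ p, gradient F ∘ p, φ, hp, hpE, hφ⟩
    · obtain ⟨φ, hφ⟩ := ConvexJet.exists_isAdmissible hω hF.convexOn hF.isC1OmegaLoc
        hF.coerciveSubspace (pt := (Subtype.val : E → _))
        (by rw [hG]; exact Submodule.eq_of_le_of_finrank_eq hle heq)
      rw [hG, hf] at hφ
      exact ⟨φ, hφ⟩
  · rintro ⟨hle, hlt, heq⟩
    rcases (Submodule.finrank_mono hle).lt_or_eq with h | h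
    · obtain ⟨p, β, w, φ, -, -, hφ⟩ := hlt h
      obtain ⟨F, -, hF⟩ := hφ.exists_isConvexExtension_sum hω hE one_pos
      exact ⟨F, hF⟩
    · obtain ⟨φ, hφ⟩ := heq h
      obtain ⟨F, -, hF⟩ := hφ.exists_isConvexExtension hω hE one_pos
      exact ⟨F, hF⟩
  · intro _ _ p β w φ _ _ hφ a ha
    exact hφ.exists_isConvexExtension_sum hω hE ha
  · intro _ _ φ hφ a ha
    exact hφ.exists_isConvexExtension hω hE ha
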